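/- Let $\alpha>0$ and let $X_\alpha=(S^2\times S^2,\ \omega_\alpha)$ with $\omega_\alpha=2(\alpha+1)\,\omega_{S^2}\oplus 2\alpha\,\omega_{S^2}$, where $\omega_{S^2}$ is the rotation invariant area form of total area $1$ on the unit sphere $S^2\subset\mathbb{R}^3$. For $a>0$ and $h\in(-\tfrac a2,\tfrac a2)$ let $S^1_h\subset (S^2,a\,\omega_{S^2})$ be the circle of constant height such that the annulus between the equator and $S^1_h$ has signed area $h$. For $(x,y)\in(-1-\alpha,1+\alpha)\times(-\alpha,\alpha)$ let $T(x,y)=S^1_x\times S^1_y\subset X_\alpha$ be the corresponding split torus. Put $r(x,y)=\max\{|x|-1,|y|\}$ and $$\Sigma=\{x=\pm(|y|+1)\}\cup[-1,1]\times\{0\}\subset\mathbb{R}^2 .$$ Let $\operatorname{Ham}(X_\alpha)$ denote the group of Hamiltonian diffeomorphisms, i.e. of time-one maps of flows of smooth time-dependent Hamiltonian functions on $X_\alpha$. Proposition 1.7. Let $L=T(x,y)\subset X_\alpha$ be a split torus with $r(x,y)\in\mathbb{R}\setminus\mathbb{Q}$ and $(x,y)\notin\Sigma$. Then for every $N\in\mathbb{N}$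 there is $\psi\in\operatorname{Ham}(X_\alpha)$ with $$\psi^k(L)\cap L=\varnothing\qquad\text{for all }k\in\{1,\dots,N\}.$$ -/

import Mathlib

open scoped Manifold ContDiff

noncomputable section

namespace SplitTori

/-- The unit sphere in `ℝ³`, with its standard smooth structure. -/
abbrev S2 : Type := Metric.sphere (0 : EuclideanSpace ℝ (Fin 3)) 1

/-- The smooth manifold `S² × S²`. -/
abbrev S2xS2 : Type := S2 × S2

/-- The model with corners of `S² × S²`. -/
abbrev I22 : ModelWithCorners ℝ (EuclideanSpace ℝ (Fin 2) × EuclideanSpace ℝ (Fin 2))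
    (ModelProd (EuclideanSpace ℝ (Fin 2)) (EuclideanSpace ℝ (Fin 2))) :=
  (𝓡 2).prod (𝓡 2)

/-- A tangent vector of the sphere, seen as a vector of `ℝ³` through the differential of the
inclusion. -/
def toAmbient (p : S2) (u : TangentSpace (𝓡 2) p) : EuclideanSpace ℝ (Fin 3) :=
  mfderiv (𝓡 2) 𝓘(ℝ, EuclideanSpace ℝ (Fin 3))
    (fun q : S2 => (q : EuclideanSpace ℝ (Fin 3))) p u

/-- The rotation invariant area form `ω_{S²}` of total area `1` on the sphere:
`(u, v) ↦ det (p, u, v) / 4π`. -/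
def areaForm (p : S2) (u v : TangentSpace (𝓡 2) p) : ℝ :=
  (1 / (4 * Real.pi)) *
    Matrix.det !![p.1 0, p.1 1, p.1 2;
      toAmbient p u 0, toAmbient p u 1, toAmbient p u 2;
      toAmbient p v 0, toAmbient p v 1, toAmbient p v 2]

/-- The symplectic form `ω_α = 2(α + 1) ω_{S²} ⊕ 2α ω_{S²}` on `S² × S²`, the sum
of the pullbacks under the two projections. -/
def omega (α : ℝ) (p : S2xS2) (u v : TangentSpace I22 p) : ℝ :=
  2 * (α + 1) *
      areaForm p.1 (mfderiv I22 (𝓡 2) Prod.fst p u) (mfderiv I22 (𝓡 2) Prod.fst p v) +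
    2 * α * areaForm p.2 (mfderiv I22 (𝓡 2) Prod.snd p u) (mfderiv I22 (𝓡 2) Prod.snd p v)

/-- The point of the sphere with longitude `θ` and latitude `l`. -/
def spherePoint (θ l : ℝ) : S2 :=
  ⟨!₂[Real.cos l * Real.cos θ, Real.cos l * Real.sin θ, Real.sin l], by
    have h1 := Real.sin_sq_add_cos_sq θ
    have h2 := Real.sin_sq_add_cos_sq l
    rw [mem_sphere_zero_iff_norm, EuclideanSpace.norm_eq, Real.sqrt_eq_one]
    simp [Fin.sum_univ_three]
    linear_combination (Real.cos l) ^ 2 * h1 + h2⟩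

/-- The signed area, for the form `a ω_{S²}`, of the annulus between the equator and the circle of
latitude `l`. It is positive for `l > 0` and negative for `l < 0`. -/
def annulusArea (a l : ℝ) : ℝ :=
  ∫ s in (0 : ℝ)..l, ∫ θ in (0 : ℝ)..(2 * Real.pi),
    a * areaForm (spherePoint θ s)
      (mfderiv 𝓘(ℝ, ℝ) (𝓡 2) (fun t : ℝ => spherePoint t s) θ (1 : ℝ))
      (mfderiv 𝓘(ℝ, ℝ) (𝓡 2) (fun t : ℝ => spherePoint θ t) s (1 : ℝ))

/-- The circle `S¹_h` of constant height in `S²(a) = (S², a ω_{S²})` such that the annulus bounded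
by the equator and `S¹_h` has signed symplectic area `h`. -/
def heightCircle (a h : ℝ) : Set S2 :=
  {p | ∃ l ∈ Set.Ioo (-(Real.pi / 2)) (Real.pi / 2), annulusArea a l = h ∧ p.1 2 = Real.sin l}

/-- The split torus `T(x, y) = S¹_x × S¹_y` in `X_α = S²(2α + 2) × S²(2α)`. -/
def splitTorus (α x y : ℝ) : Set S2xS2 :=
  heightCircle (2 * α + 2) x ×ˢ heightCircle (2 * α) y

/-- `φ` is the flow, starting at the identity, of the smooth time-dependent Hamiltonian `H` on
`X_α`: one has `ω_α (∂_t φ_t, ·) = d H_t` at `φ_t p`, for all `t` and `p`. -/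
structure IsHamiltonianFlow (α : ℝ) (H : ℝ → S2xS2 → ℝ) (φ : ℝ → S2xS2 → S2xS2) : Prop where
  smooth_ham : ContMDiff (𝓘(ℝ, ℝ).prod I22) 𝓘(ℝ, ℝ) ∞ (fun q : ℝ × S2xS2 => H q.1 q.2)
  smooth_flow : ContMDiff (𝓘(ℝ, ℝ).prod I22) I22 ∞ (fun q : ℝ × S2xS2 => φ q.1 q.2)
  flow_zero : ∀ p, φ 0 p = p
  hamilton : ∀ (t : ℝ) (p : S2xS2) (v : TangentSpace I22 (φ t p)),
    omega α (φ t p) (mfderiv 𝓘(ℝ, ℝ) I22 (fun s : ℝ => φ s p) t (1 : ℝ)) v =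
      mfderiv I22 𝓘(ℝ, ℝ) (H t) (φ t p) v

/-- `Ham(X_α)`: the time-one maps of Hamiltonian flows. These are automatically diffeomorphisms,
since the flow of a smooth time-dependent vector field is invertible with smooth inverse. -/
def Ham (α : ℝ) : Set (S2xS2 → S2xS2) :=
  {ψ | ∃ H φ, IsHamiltonianFlow α H φ ∧ φ 1 = ψ}

/-- `r(x, y) = max {|x| - 1, |y|}`. -/
def tableRadius (x y : ℝ) : ℝ := max (|x| - 1) |y|

/-- `Σ = {x = ±(|y| + 1)} ∪ [-1, 1] × {0}`: the points of the plane which are corners of their own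
billiard table `[-1 - r, 1 + r] × [-r, r]`, where `r = r(x, y)`, or whose table is degenerate. -/
def cornerSet : Set (ℝ × ℝ) :=
  {p | p.1 = |p.2| + 1 ∨ p.1 = -(|p.2| + 1)} ∪ Set.Icc (-1) 1 ×ˢ {0}

end SplitTori

end

noncomputable section

namespace SplitTori

open Filter Topology

/-! All points of a split torus have the same value `(x, y)` under `moment`, so it is enough to find
a Hamiltonian map whose first `N` iterates carry this value to other values. The function `level`,
the difference of the two moment components, generates the circle action `antiRot`. Its reduced
space at level `c` is a sphere lying over the chord `x - y = c` of the moment rectangle, and a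
half-turn of that sphere reverses the chord. If `|c| < 1` the chord joins the horizontal sides and
its reversal is `(x, y) ↦ (x - 2y, -y)`. If `c > 1` it cuts off a corner and the reversal is `(x, y)
↦ (1 - y, 1 - x)`. `exists_cutoff_flow` extends such flows to all of `S² × S²`; `exists_mid_flip`
and `exists_cap_flip` apply it, giving the reversals away from the levels `±1`.

Combined with `y ↦ -y`, the reversals act as `tableMap`. On the boundary of `[-1 - r, 1 + r] × [-r,
r]` this is a rotation by arc length `2r` (`AtPosition.tableMap`). Half the perimeter is `2 + 4r`,
so for irrational `r` no positive iterate has a fixed point.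

What remains is to keep the orbit off the levels `±1`, which are the positions `0` and `-4r` modulo
`2 + 4r`. If the forward orbit of `(x, y)` meets them, then that of `(x, -y)` does not, because `(x,
y)` is not a corner (`exists_infinite_orbit`); the map is then conjugated by a reflection. A finite
piece of a good orbit keeps a positive distance from the bad levels, so a single cutoff serves for
all `k ≤ N` (`exists_ham_orbit`); this is why the map depends on `N`. -/

/-! ### Ambient coordinates for the sphere, the symplectic form and Hamilton's equation. -/

/-- The Cartesian coordinates of a point of the sphere. -/
def vec (p : S2) : Fin 3 → ℝ := fun i => p.1 i

/-- The coordinates as a continuous linear equivalence. -/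
abbrev coordEquiv : EuclideanSpace ℝ (Fin 3) ≃L[ℝ] (Fin 3 → ℝ) := EuclideanSpace.equiv (Fin 3) ℝ

lemma vec_injective : Function.Injective vec := fun p q h => by
  apply Subtype.ext
  exact coordEquiv.injective h

lemma vec_sq (p : S2) : vec p 0 ^ 2 + vec p 1 ^ 2 + vec p 2 ^ 2 = 1 := by
  have h := p.2
  rw [mem_sphere_zero_iff_norm, EuclideanSpace.norm_eq, Real.sqrt_eq_one] at h
  simpa [Fin.sum_univ_three, vec] using h

/-- The point of the sphere with given coordinates. -/
def ofVec (v : Fin 3 → ℝ) (h : v 0 ^ 2 + v 1 ^ 2 + v 2 ^ 2 = 1) : S2 :=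
  ⟨WithLp.toLp 2 v, by
    rw [mem_sphere_zero_iff_norm, EuclideanSpace.norm_eq, Real.sqrt_eq_one]
    simpa [Fin.sum_univ_three] using h⟩

@[simp] lemma vec_ofVec (v : Fin 3 → ℝ) (h) : vec (ofVec v h) = v := rfl

lemma fact_finrank : Fact (Module.finrank ℝ (EuclideanSpace ℝ (Fin 3)) = 2 + 1) :=
  ⟨finrank_euclideanSpace_fin⟩

lemma contMDiff_coe : ContMDiff (𝓡 2) 𝓘(ℝ, EuclideanSpace ℝ (Fin 3)) ∞
    (fun q : S2 => (q : EuclideanSpace ℝ (Fin 3))) :=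
  have := fact_finrank
  contMDiff_coe_sphere

lemma contMDiff_vec : ContMDiff (𝓡 2) 𝓘(ℝ, Fin 3 → ℝ) ∞ vec :=
  coordEquiv.contDiff.contMDiff.comp contMDiff_coe

lemma mdifferentiableAt_coe (p : S2) : MDifferentiableAt (𝓡 2) 𝓘(ℝ, EuclideanSpace ℝ (Fin 3))
    (fun q : S2 => (q : EuclideanSpace ℝ (Fin 3))) p :=
  contMDiff_coe.mdifferentiableAt (by simp)

lemma mdifferentiableAt_vec (p : S2) : MDifferentiableAt (𝓡 2) 𝓘(ℝ, Fin 3 → ℝ) vec p :=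
  contMDiff_vec.mdifferentiableAt (by simp)

lemma mfderiv_vec (p : S2) (u : TangentSpace (𝓡 2) p) :
    mfderiv (𝓡 2) 𝓘(ℝ, Fin 3 → ℝ) vec p u = coordEquiv (toAmbient p u) := by
  have h : vec = coordEquiv ∘ (fun q : S2 => (q : EuclideanSpace ℝ (Fin 3))) := rfl
  rw [h, mfderiv_comp (I' := 𝓘(ℝ, EuclideanSpace ℝ (Fin 3))) p
    (coordEquiv.differentiableAt.mdifferentiableAt) (mdifferentiableAt_coe p)]
  simp only [mfderiv_eq_fderiv, toAmbient]
  erw [coordEquiv.fderiv]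
  rfl

lemma inner_toAmbient (p : S2) (u : TangentSpace (𝓡 2) p) :
    vec p 0 * toAmbient p u 0 + vec p 1 * toAmbient p u 1 + vec p 2 * toAmbient p u 2 = 0 := by
  have h : toAmbient p u ∈ (ℝ ∙ (p : EuclideanSpace ℝ (Fin 3)))ᗮ := by
    have := fact_finrank
    rw [← range_mvfderiv_subtypeVal (n := 2) p]
    exact ⟨u, rfl⟩
  rw [Submodule.mem_orthogonal_singleton_iff_inner_right] at h
  simp [PiLp.inner_apply, Fin.sum_univ_three] at h
  simp only [vec]
  linarith

lemma contMDiff_of_vec {E H M : Type*} [NormedAddCommGroup E] [NormedSpace ℝ E]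
    [TopologicalSpace H] {I : ModelWithCorners ℝ E H} [TopologicalSpace M] [ChartedSpace H M]
    [IsManifold I ∞ M]
    {f : M → S2} (hf : ContMDiff I 𝓘(ℝ, Fin 3 → ℝ) ∞ fun x => vec (f x)) :
    ContMDiff I (𝓡 2) ∞ f := by
  have h : ContMDiff I 𝓘(ℝ, EuclideanSpace ℝ (Fin 3)) ∞
      (fun x => (f x : EuclideanSpace ℝ (Fin 3))) :=
    coordEquiv.symm.contDiff.contMDiff.comp hf
  have := fact_finrank
  exact ContMDiff.codRestrict_sphere (n := 2) h (fun x => (f x).2)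

/-- The determinant of three vectors of `ℝ³`. -/
def det3 (a b c : Fin 3 → ℝ) : ℝ :=
  a 0 * (b 1 * c 2 - b 2 * c 1) - a 1 * (b 0 * c 2 - b 2 * c 0) + a 2 * (b 0 * c 1 - b 1 * c 0)

lemma areaForm_eq (p : S2) (u v : TangentSpace (𝓡 2) p) :
    areaForm p u v = 1 / (4 * Real.pi) *
      det3 (vec p) (coordEquiv (toAmbient p u)) (coordEquiv (toAmbient p v)) := by
  simp [areaForm, det3, vec, Matrix.det_fin_three]
  ring

/-- The velocity of a curve on the sphere, in coordinates. -/
lemma coord_toAmbient_mfderiv {γ : ℝ → S2} {t : ℝ} {d : Fin 3 → ℝ}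
    (hγ : MDifferentiableAt 𝓘(ℝ, ℝ) (𝓡 2) γ t) (hd : HasDerivAt (fun s => vec (γ s)) d t) :
    coordEquiv (toAmbient (γ t) (mfderiv 𝓘(ℝ, ℝ) (𝓡 2) γ t (1 : ℝ))) = d := by
  have h := mfderiv_comp (I' := 𝓡 2) (I'' := 𝓘(ℝ, Fin 3 → ℝ)) t (mdifferentiableAt_vec (γ t)) hγ
  rw [mfderiv_eq_fderiv] at h
  have h2 := congrArg (fun L : ℝ →L[ℝ] (Fin 3 → ℝ) => L 1) h
  simp only [fderiv_eq_smul_deriv, one_smul] at h2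
  rw [← mfderiv_vec, ← hd.deriv]
  exact h2.symm

/-- The symplectic form in coordinates. -/
def ambientForm (α : ℝ) (p₁ d₁ v₁ p₂ d₂ v₂ : Fin 3 → ℝ) : ℝ :=
  (α + 1) / (2 * Real.pi) * det3 p₁ d₁ v₁ + α / (2 * Real.pi) * det3 p₂ d₂ v₂

/-- The coordinates of a point of `S² × S²`. -/
def vec2 (p : S2xS2) : (Fin 3 → ℝ) × (Fin 3 → ℝ) := (vec p.1, vec p.2)

lemma contMDiff_vec2 : ContMDiff I22 (𝓘(ℝ, (Fin 3 → ℝ) × (Fin 3 → ℝ))) ∞ vec2 :=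
  (contMDiff_vec.comp contMDiff_fst).prodMk_space (contMDiff_vec.comp contMDiff_snd)

lemma mdifferentiableAt_vec2 (p : S2xS2) :
    MDifferentiableAt I22 (𝓘(ℝ, (Fin 3 → ℝ) × (Fin 3 → ℝ))) vec2 p :=
  contMDiff_vec2.mdifferentiableAt (by simp)

lemma mfderiv_vec2 (p : S2xS2) (u : TangentSpace I22 p) :
    mfderiv I22 (𝓘(ℝ, (Fin 3 → ℝ) × (Fin 3 → ℝ))) vec2 p u =
      (coordEquiv (toAmbient p.1 (mfderiv I22 (𝓡 2) Prod.fst p u)),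
       coordEquiv (toAmbient p.2 (mfderiv I22 (𝓡 2) Prod.snd p u))) := by
  have h1 := mfderiv_comp (I' := 𝓡 2) (I'' := 𝓘(ℝ, Fin 3 → ℝ)) p (mdifferentiableAt_vec p.1)
    (mdifferentiableAt_fst (I := 𝓡 2) (I' := 𝓡 2))
  have h2 := mfderiv_comp (I' := 𝓡 2) (I'' := 𝓘(ℝ, Fin 3 → ℝ)) p (mdifferentiableAt_vec p.2)
    (mdifferentiableAt_snd (I := 𝓡 2) (I' := 𝓡 2))
  have g1 := mfderiv_comp (I' := 𝓘(ℝ, (Fin 3 → ℝ) × (Fin 3 → ℝ))) (I'' := 𝓘(ℝ, Fin 3 → ℝ)) p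
    ((differentiableAt_fst (𝕜 := ℝ) (p := vec2 p)).mdifferentiableAt) (mdifferentiableAt_vec2 p)
  have g2 := mfderiv_comp (I' := 𝓘(ℝ, (Fin 3 → ℝ) × (Fin 3 → ℝ))) (I'' := 𝓘(ℝ, Fin 3 → ℝ)) p
    ((differentiableAt_snd (𝕜 := ℝ) (p := vec2 p)).mdifferentiableAt) (mdifferentiableAt_vec2 p)
  rw [← mfderiv_vec, ← mfderiv_vec]
  have e1 := h1.symm.trans g1
  have e2 := h2.symm.trans g2
  rw [mfderiv_eq_fderiv, fderiv_fst] at e1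
  rw [mfderiv_eq_fderiv, fderiv_snd] at e2
  exact Prod.ext (DFunLike.congr_fun e1 u).symm (DFunLike.congr_fun e2 u).symm

lemma omega_eq (α : ℝ) (p : S2xS2) (u v : TangentSpace I22 p) :
    omega α p u v = ambientForm α
      (vec p.1) (coordEquiv (toAmbient p.1 (mfderiv I22 (𝓡 2) Prod.fst p u)))
      (coordEquiv (toAmbient p.1 (mfderiv I22 (𝓡 2) Prod.fst p v)))
      (vec p.2) (coordEquiv (toAmbient p.2 (mfderiv I22 (𝓡 2) Prod.snd p u)))
      (coordEquiv (toAmbient p.2 (mfderiv I22 (𝓡 2) Prod.snd p v))) := by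
  rw [omega, areaForm_eq, areaForm_eq, ambientForm]
  have := Real.pi_ne_zero
  field_simp
  ring

/-- The scalar product of `ℝ³`. -/
def dot3 (a b : Fin 3 → ℝ) : ℝ := a 0 * b 0 + a 1 * b 1 + a 2 * b 2

/-- Hamilton's equation for the flow of an autonomous Hamiltonian can be checked in coordinates. -/
theorem isHamiltonianFlow_of_coordinates {α : ℝ} {H : S2xS2 → ℝ} {φ : ℝ → S2xS2 → S2xS2}
    (hH : ContMDiff I22 𝓘(ℝ, ℝ) ∞ H)
    (hφ : ContMDiff (𝓘(ℝ, ℝ).prod I22) (𝓘(ℝ, (Fin 3 → ℝ) × (Fin 3 → ℝ))) ∞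
      (fun q : ℝ × S2xS2 => vec2 (φ q.1 q.2)))
    (h0 : ∀ p, φ 0 p = p)
    (hham : ∀ t p, ∃ F : (Fin 3 → ℝ) × (Fin 3 → ℝ) → ℝ,
      DifferentiableAt ℝ F (vec2 (φ t p)) ∧ H =ᶠ[𝓝 (φ t p)] (fun q => F (vec2 q)) ∧
      ∃ d, HasDerivAt (fun s => vec2 (φ s p)) d t ∧
        ∀ v₁ v₂, dot3 (vec (φ t p).1) v₁ = 0 → dot3 (vec (φ t p).2) v₂ = 0 →
          ambientForm α (vec (φ t p).1) d.1 v₁ (vec (φ t p).2) d.2 v₂ =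
            fderiv ℝ F (vec2 (φ t p)) (v₁, v₂)) :
    IsHamiltonianFlow α (fun _ => H) φ := by
  have hsm : ContMDiff (𝓘(ℝ, ℝ).prod I22) I22 ∞ (fun q : ℝ × S2xS2 => φ q.1 q.2) := by
    refine ContMDiff.prodMk (contMDiff_of_vec ?_) (contMDiff_of_vec ?_)
    · exact contDiff_fst.contMDiff.comp hφ
    · exact contDiff_snd.contMDiff.comp hφ
  refine ⟨hH.comp contMDiff_snd, hsm, h0, fun t p v => ?_⟩
  obtain ⟨F, hF, hHF, d, hd, heq⟩ := hham t p
  have hcurve : MDifferentiableAt 𝓘(ℝ, ℝ) I22 (fun s : ℝ => φ s p) t :=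
    ((hsm.comp (contMDiff_id.prodMk contMDiff_const) :
      ContMDiff 𝓘(ℝ, ℝ) I22 ∞ (fun s : ℝ => φ s p))).mdifferentiableAt (by simp)
  have hvel := mfderiv_comp (I' := I22) (I'' := 𝓘(ℝ, (Fin 3 → ℝ) × (Fin 3 → ℝ))) t
    (mdifferentiableAt_vec2 (φ t p)) hcurve
  rw [mfderiv_eq_fderiv] at hvel
  have hvel2 := congrArg (fun L : ℝ →L[ℝ] (Fin 3 → ℝ) × (Fin 3 → ℝ) => L 1) hvel
  simp only [fderiv_eq_smul_deriv, one_smul] at hvel2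
  have hvel3 := hvel2.trans
    (mfderiv_vec2 (φ t p) (mfderiv 𝓘(ℝ, ℝ) I22 (fun s : ℝ => φ s p) t (1 : ℝ)))
  have hvel4 : d = _ := (hd.deriv.symm.trans hvel3)
  have h1 := congrArg Prod.fst hvel4
  have h2 := congrArg Prod.snd hvel4
  rw [omega_eq]
  simp only at h1 h2
  rw [← h1, ← h2, hHF.mfderiv_eq]
  have hcomp := mfderiv_comp (I' := 𝓘(ℝ, (Fin 3 → ℝ) × (Fin 3 → ℝ))) (I'' := 𝓘(ℝ, ℝ)) (φ t p)
    hF.mdifferentiableAt (mdifferentiableAt_vec2 (φ t p))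
  rw [mfderiv_eq_fderiv] at hcomp
  have := DFunLike.congr_fun hcomp v
  -- Coordinates of tangent vectors are orthogonal to the base points, so the ambient identity is
  -- needed only for such `v₁`, `v₂`.
  have key := heq _ _
    (inner_toAmbient (φ t p).1 (mfderiv I22 (𝓡 2) Prod.fst (φ t p) v))
    (inner_toAmbient (φ t p).2 (mfderiv I22 (𝓡 2) Prod.snd (φ t p) v))
  refine (key.trans ?_).trans this.symm
  exact congrArg (fderiv ℝ F (vec2 (φ t p))) (mfderiv_vec2 (φ t p) v).symm

/-! ### Reparametrisation and concatenation of Hamiltonian flows. -/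

lemma omega_smul_left (α : ℝ) (p : S2xS2) (c : ℝ) (u v : TangentSpace I22 p) :
    omega α p (c • u) v = c * omega α p u v := by
  have h1 : mfderiv I22 (𝓡 2) Prod.fst p (c • u) = c • mfderiv I22 (𝓡 2) Prod.fst p u :=
    map_smul _ c u
  have h2 : mfderiv I22 (𝓡 2) Prod.snd p (c • u) = c • mfderiv I22 (𝓡 2) Prod.snd p u :=
    map_smul _ c u
  have h3 (q : S2) (w : TangentSpace (𝓡 2) q) : toAmbient q (c • w) = c • toAmbient q w :=
    map_smul _ c w
  simp only [omega_eq, h1, h2, h3, map_smul, ambientForm, det3, Pi.smul_apply, smul_eq_mul]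
  ring

lemma hamilton_reparam {α : ℝ} {γ : ℝ → S2xS2} {β : ℝ → ℝ} {t : ℝ} {H : S2xS2 → ℝ}
    (hγ : MDifferentiableAt 𝓘(ℝ, ℝ) I22 γ (β t)) (hβ : DifferentiableAt ℝ β t)
    (hH : MDifferentiableAt I22 𝓘(ℝ, ℝ) H (γ (β t)))
    (h : ∀ v : TangentSpace I22 (γ (β t)),
      omega α (γ (β t)) (mfderiv 𝓘(ℝ, ℝ) I22 γ (β t) (1 : ℝ)) v =
        mfderiv I22 𝓘(ℝ, ℝ) H (γ (β t)) v) (v : TangentSpace I22 (γ (β t))) :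
    omega α (γ (β t)) (mfderiv 𝓘(ℝ, ℝ) I22 (fun s => γ (β s)) t (1 : ℝ)) v =
      mfderiv I22 𝓘(ℝ, ℝ) (fun q => deriv β t * H q) (γ (β t)) v := by
  have h1 := mfderiv_comp (I' := 𝓘(ℝ, ℝ)) (I'' := I22) t hγ hβ.mdifferentiableAt
  have h2 : mfderiv 𝓘(ℝ, ℝ) I22 (fun s => γ (β s)) t (1 : ℝ) =
      deriv β t • mfderiv 𝓘(ℝ, ℝ) I22 γ (β t) (1 : ℝ) := by
    refine (DFunLike.congr_fun h1 (1 : ℝ)).trans ?_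
    rw [mfderiv_eq_fderiv]
    change mfderiv 𝓘(ℝ, ℝ) I22 γ (β t) (fderiv ℝ β t 1) = _
    have : fderiv ℝ β t 1 = deriv β t • (1 : ℝ) := by simp
    rw [this]
    exact map_smul (mfderiv 𝓘(ℝ, ℝ) I22 γ (β t)) (deriv β t) (1 : ℝ)
  have h3 := const_smul_mfderiv hH (deriv β t)
  rw [h2, omega_smul_left, h v]
  exact (DFunLike.congr_fun h3 v).symm

/-- Hamilton's equation depends only on the germ of the curve. The tangent spaces at `γ t` and `γ'
t` depend on the base point, so the equality of base points is substituted in a general statement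
first. -/
lemma hamilton_congr {α : ℝ} {γ γ' : ℝ → S2xS2} {t : ℝ} {H : S2xS2 → ℝ} (hγ : γ =ᶠ[𝓝 t] γ')
    (h : ∀ v : TangentSpace I22 (γ' t), omega α (γ' t) (mfderiv 𝓘(ℝ, ℝ) I22 γ' t (1 : ℝ)) v =
      mfderiv I22 𝓘(ℝ, ℝ) H (γ' t) v) (v : TangentSpace I22 (γ t)) :
    omega α (γ t) (mfderiv 𝓘(ℝ, ℝ) I22 γ t (1 : ℝ)) v = mfderiv I22 𝓘(ℝ, ℝ) H (γ t) v := by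
  have key (q : S2xS2) (D : EuclideanSpace ℝ (Fin 2) × EuclideanSpace ℝ (Fin 2)) (hq : q = γ' t)
      (hD : D = mfderiv 𝓘(ℝ, ℝ) I22 γ' t (1 : ℝ)) (v : TangentSpace I22 q) :
      omega α q D v = mfderiv I22 𝓘(ℝ, ℝ) H q v := by
    subst hq hD
    exact h v
  refine key (γ t) _ hγ.eq_of_nhds ?_ v
  exact DFunLike.congr_fun (F := ℝ →L[ℝ] EuclideanSpace ℝ (Fin 2) × EuclideanSpace ℝ (Fin 2))
    hγ.mfderiv_eq (1 : ℝ)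

/-- The composition of two Hamiltonian diffeomorphisms is Hamiltonian. -/
theorem comp_mem_Ham {α : ℝ} {ψ₁ ψ₂ : S2xS2 → S2xS2} (h₂ : ψ₂ ∈ Ham α) (h₁ : ψ₁ ∈ Ham α) :
    ψ₂ ∘ ψ₁ ∈ Ham α := by
  obtain ⟨H, φ, hφ, rfl⟩ := h₁
  obtain ⟨G, η, hη, rfl⟩ := h₂
  -- The first flow is run during `[0, 1/3]` and the second during `[2/3, 1]`. The pause between
  -- them makes the concatenation smooth, and at each instant at most one Hamiltonian is active.
  let a : ℝ → ℝ := fun t => Real.smoothTransition (3 * t)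
  let b : ℝ → ℝ := fun t => Real.smoothTransition (3 * t - 2)
  have ha : ContDiff ℝ ∞ a := Real.smoothTransition.contDiff.comp (by fun_prop)
  have hb : ContDiff ℝ ∞ b := Real.smoothTransition.contDiff.comp (by fun_prop)
  have ha' : ContDiff ℝ ∞ (deriv a) := by
    have := contDiff_infty_iff_deriv.1 ha
    exact this.2
  have hb' : ContDiff ℝ ∞ (deriv b) := by
    have := contDiff_infty_iff_deriv.1 hb
    exact this.2
  have hb0 (t : ℝ) (ht : t < 2 / 3) : b t = 0 :=
    Real.smoothTransition.zero_of_nonpos (by linarith)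
  have ha1 (t : ℝ) (ht : 1 / 3 < t) : a t = 1 :=
    Real.smoothTransition.one_of_one_le (by linarith)
  have a0 : a 0 = 0 := by simp [a]
  have b1 : b 1 = 1 := Real.smoothTransition.one_of_one_le (by norm_num)
  clear_value a b
  have hb0' (t : ℝ) (ht : t < 2 / 3) : deriv b t = 0 := by
    have : b =ᶠ[𝓝 t] fun _ => 0 := by
      filter_upwards [Iio_mem_nhds ht] with s hs using hb0 s hs
    rw [this.deriv_eq, deriv_const]
  have ha1' (t : ℝ) (ht : 1 / 3 < t) : deriv a t = 0 := by
    have : a =ᶠ[𝓝 t] fun _ => 1 := by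
      filter_upwards [Ioi_mem_nhds ht] with s hs using ha1 s hs
    rw [this.deriv_eq, deriv_const]
  have curve {H : ℝ → S2xS2 → ℝ} {φ} (h : IsHamiltonianFlow α H φ) (p : S2xS2) (t : ℝ) :
      MDifferentiableAt 𝓘(ℝ, ℝ) I22 (fun s => φ s p) t :=
    ((h.smooth_flow.comp (contMDiff_id.prodMk contMDiff_const) :
      ContMDiff 𝓘(ℝ, ℝ) I22 ∞ (fun s : ℝ => φ s p))).mdifferentiableAt (by simp)
  have ham {H : ℝ → S2xS2 → ℝ} {φ} (h : IsHamiltonianFlow α H φ) (p : S2xS2) (t : ℝ) :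
      MDifferentiableAt I22 𝓘(ℝ, ℝ) (H t) p :=
    ((h.smooth_ham.comp (contMDiff_const.prodMk contMDiff_id) :
      ContMDiff I22 𝓘(ℝ, ℝ) ∞ (H t))).mdifferentiableAt (by simp)
  have main (t : ℝ) (p : S2xS2) (v : TangentSpace I22 (η (b t) (φ (a t) p))) :
      omega α (η (b t) (φ (a t) p))
        (mfderiv 𝓘(ℝ, ℝ) I22 (fun s : ℝ => η (b s) (φ (a s) p)) t (1 : ℝ)) v =
      mfderiv I22 𝓘(ℝ, ℝ) (fun q => deriv a t * H (a t) q + deriv b t * G (b t) q)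
        (η (b t) (φ (a t) p)) v := by
    rcases lt_or_ge t (1 / 2) with ht | ht
    · have e1 : (fun s => η (b s) (φ (a s) p)) =ᶠ[𝓝 t] fun s => φ (a s) p := by
        filter_upwards [Iio_mem_nhds (show t < 2 / 3 by linarith)] with s hs
        rw [hb0 s hs, hη.flow_zero]
      have e2 : (fun q => deriv a t * H (a t) q + deriv b t * G (b t) q) =
          fun q => deriv a t * H (a t) q := by
        funext q
        rw [hb0' t (by linarith)]
        ring
      rw [e2]
      exact hamilton_congr e1 (hamilton_reparam (γ := fun s => φ s p) (β := a) (t := t) (H := H (a t))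
        (curve hφ p (a t))
        (ha.differentiable (by simp) t) (ham hφ _ _) (hφ.hamilton (a t) p)) v
    · have e1 : (fun s => η (b s) (φ (a s) p)) =ᶠ[𝓝 t] fun s => η (b s) (φ 1 p) := by
        filter_upwards [Ioi_mem_nhds (show 1 / 3 < t by linarith)] with s hs
        rw [ha1 s hs]
      have e2 : (fun q => deriv a t * H (a t) q + deriv b t * G (b t) q) =
          fun q => deriv b t * G (b t) q := by
        funext q
        rw [ha1' t (by linarith)]
        ring
      rw [e2]
      exact hamilton_congr e1 (hamilton_reparam (γ := fun s => η s (φ 1 p)) (β := b) (t := t) (H := G (b t))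
        (curve hη _ (b t))
        (hb.differentiable (by simp) t) (ham hη _ _) (hη.hamilton (b t) (φ 1 p))) v
  refine ⟨fun t q => deriv a t * H (a t) q + deriv b t * G (b t) q,
    fun t p => η (b t) (φ (a t) p), ⟨?_, ?_, ?_, ?_⟩, ?_⟩
  · have e (β : ℝ → ℝ) (hβ : ContDiff ℝ ∞ β) (K : ℝ → S2xS2 → ℝ)
        (hK : ContMDiff (𝓘(ℝ, ℝ).prod I22) 𝓘(ℝ, ℝ) ∞ (fun q : ℝ × S2xS2 => K q.1 q.2)) :
        ContMDiff (𝓘(ℝ, ℝ).prod I22) 𝓘(ℝ, ℝ) ∞ (fun q : ℝ × S2xS2 => K (β q.1) q.2) :=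
      hK.comp ((hβ.contMDiff.comp contMDiff_fst).prodMk contMDiff_snd)
    exact ((ha'.contMDiff.comp contMDiff_fst).mul (e a ha H hφ.smooth_ham)).add
      ((hb'.contMDiff.comp contMDiff_fst).mul (e b hb G hη.smooth_ham))
  · exact hη.smooth_flow.comp ((hb.contMDiff.comp contMDiff_fst).prodMk
      (hφ.smooth_flow.comp ((ha.contMDiff.comp contMDiff_fst).prodMk contMDiff_snd)))
  · intro p
    rw [hb0 0 (by norm_num), a0, hφ.flow_zero, hη.flow_zero]
  · exact main
  · funext p
    change η (b 1) (φ (a 1) p) = _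
    rw [ha1 1 (by norm_num), b1]
    rfl

/-! ### Split tori -/

lemma hasDerivAt_vec3 {f g h : ℝ → ℝ} {f' g' h' t : ℝ} (hf : HasDerivAt f f' t)
    (hg : HasDerivAt g g' t) (hh : HasDerivAt h h' t) :
    HasDerivAt (fun s => (![f s, g s, h s] : Fin 3 → ℝ)) ![f', g', h'] t := by
  rw [hasDerivAt_pi]
  intro i
  fin_cases i <;> simpa

lemma vec_spherePoint (θ l : ℝ) : vec (spherePoint θ l) =
    ![Real.cos l * Real.cos θ, Real.cos l * Real.sin θ, Real.sin l] := by
  funext i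
  fin_cases i <;> rfl

lemma areaForm_spherePoint (θ l : ℝ) :
    areaForm (spherePoint θ l)
      (mfderiv 𝓘(ℝ, ℝ) (𝓡 2) (fun t : ℝ => spherePoint t l) θ (1 : ℝ))
      (mfderiv 𝓘(ℝ, ℝ) (𝓡 2) (fun t : ℝ => spherePoint θ t) l (1 : ℝ)) =
    Real.cos l / (4 * Real.pi) := by
  have hc : ContMDiff 𝓘(ℝ, ℝ) (𝓡 2) ∞ (fun t : ℝ => spherePoint t l) := by
    apply contMDiff_of_vec
    simp only [vec_spherePoint]
    apply ContDiff.contMDiff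
    rw [contDiff_pi]
    intro i
    fin_cases i <;> simp <;> fun_prop
  have hc' : ContMDiff 𝓘(ℝ, ℝ) (𝓡 2) ∞ (fun t : ℝ => spherePoint θ t) := by
    apply contMDiff_of_vec
    simp only [vec_spherePoint]
    apply ContDiff.contMDiff
    rw [contDiff_pi]
    intro i
    fin_cases i <;> simp <;> fun_prop
  have h1 : HasDerivAt (fun t => vec (spherePoint t l)) ![Real.cos l * -Real.sin θ,
      Real.cos l * Real.cos θ, 0] θ := by
    simp only [vec_spherePoint]
    exact hasDerivAt_vec3 ((Real.hasDerivAt_cos θ).const_mul _)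
      ((Real.hasDerivAt_sin θ).const_mul _) (hasDerivAt_const _ _)
  have h2 : HasDerivAt (fun t => vec (spherePoint θ t)) ![-Real.sin l * Real.cos θ,
      -Real.sin l * Real.sin θ, Real.cos l] l := by
    simp only [vec_spherePoint]
    exact hasDerivAt_vec3 ((Real.hasDerivAt_cos l).mul_const _)
      ((Real.hasDerivAt_cos l).mul_const _) (Real.hasDerivAt_sin l)
  have e1 := coord_toAmbient_mfderiv (hc.mdifferentiableAt (by simp)) h1
  have e2 := coord_toAmbient_mfderiv (hc'.mdifferentiableAt (by simp)) h2
  rw [areaForm_eq]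
  erw [e1, e2]
  rw [vec_spherePoint]
  simp only [det3, Matrix.cons_val]
  have h3 := Real.sin_sq_add_cos_sq θ
  have h4 := Real.sin_sq_add_cos_sq l
  linear_combination (Real.cos l / (4 * Real.pi)) * (Real.cos l ^ 2 * h3 + Real.sin l ^ 2 * h3 + h4)

/-- Archimedes: area is proportional to height. With `a = 2α + 2` and `a = 2α` the signed areas
become exactly the components of `moment`. -/
lemma annulusArea_eq (a l : ℝ) : annulusArea a l = a / 2 * Real.sin l := by
  simp only [annulusArea, areaForm_spherePoint, intervalIntegral.integral_const, smul_eq_mul,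
    sub_zero]
  rw [intervalIntegral.integral_const_mul, intervalIntegral.integral_const_mul,
    intervalIntegral.integral_div, integral_cos]
  have := Real.pi_ne_zero
  field_simp
  simp
  ring

/-- The moment map of `X_α`. -/
def moment (α : ℝ) (p : S2xS2) : ℝ × ℝ := ((1 + α) * vec p.1 2, α * vec p.2 2)

/-- This is all that is needed about the tori: sets with distinct moment values are disjoint. -/
lemma moment_of_mem_splitTorus {α x y : ℝ} {p : S2xS2} (hp : p ∈ splitTorus α x y) :
    moment α p = (x, y) := by
  obtain ⟨⟨l, -, h1, h2⟩, ⟨m, -, h3, h4⟩⟩ := hp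
  rw [annulusArea_eq] at h1 h3
  simp only [moment, vec, h2, h4, ← h1, ← h3]
  ext <;> ring

lemma fderiv_apply_of_hasDerivAt_line {F : (Fin 3 → ℝ) × (Fin 3 → ℝ) → ℝ}
    {w v : (Fin 3 → ℝ) × (Fin 3 → ℝ)} {D : ℝ} (hF : DifferentiableAt ℝ F w)
    (h : HasDerivAt (fun s : ℝ => F (w + s • v)) D 0) : fderiv ℝ F w v = D := by
  have h1 : HasDerivAt (fun s : ℝ => w + s • v) v 0 := by
    simpa using ((hasDerivAt_id (0 : ℝ)).smul_const v).const_add w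
  have h2 : HasFDerivAt F (fderiv ℝ F w) (w + (0 : ℝ) • v) := by simpa using hF.hasFDerivAt
  exact (h2.comp_hasDerivAt (0 : ℝ) h1).unique h

lemma contDiff_vec3 {E : Type*} [NormedAddCommGroup E] [NormedSpace ℝ E] {f g h : E → ℝ}
    (hf : ContDiff ℝ ∞ f) (hg : ContDiff ℝ ∞ g) (hh : ContDiff ℝ ∞ h) :
    ContDiff ℝ ∞ (fun x => (![f x, g x, h x] : Fin 3 → ℝ)) := by
  rw [contDiff_pi]
  intro i
  fin_cases i <;> simpa

lemma contDiffAt_vec3 {E : Type*} [NormedAddCommGroup E] [NormedSpace ℝ E] {f g h : E → ℝ}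
    {x : E} (hf : ContDiffAt ℝ ∞ f x) (hg : ContDiffAt ℝ ∞ g x) (hh : ContDiffAt ℝ ∞ h x) :
    ContDiffAt ℝ ∞ (fun x => (![f x, g x, h x] : Fin 3 → ℝ)) x := by
  rw [contDiffAt_pi]
  intro i
  fin_cases i <;> simpa

/-! ### Rotations of the factors about horizontal axes. -/

/-- The rotation of the sphere by the angle `b` about the first coordinate axis. -/
def rotX (b : ℝ) (p : S2) : S2 :=
  ofVec ![vec p 0, vec p 1 * Real.cos b - vec p 2 * Real.sin b,
    vec p 1 * Real.sin b + vec p 2 * Real.cos b] (by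
      have h1 := vec_sq p
      have h2 := Real.sin_sq_add_cos_sq b
      simp only [Matrix.cons_val]
      linear_combination h1 + (vec p 1 ^ 2 + vec p 2 ^ 2) * h2)

/-- A coordinate function generates the rotation about its axis. Weighting the two coordinates by
the areas of the factors makes the angles independent; half-turns then change the signs of the
moment components. -/
lemma prodMap_rotX_mem_Ham (α a b : ℝ) :
    Prod.map (rotX a) (rotX b) ∈ Ham α := by
  let L₁ : (Fin 3 → ℝ) × (Fin 3 → ℝ) →L[ℝ] ℝ :=
    (ContinuousLinearMap.proj (R := ℝ) (φ := fun _ : Fin 3 => ℝ) 0).comp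
      (ContinuousLinearMap.fst ℝ (Fin 3 → ℝ) (Fin 3 → ℝ))
  let L₂ : (Fin 3 → ℝ) × (Fin 3 → ℝ) →L[ℝ] ℝ :=
    (ContinuousLinearMap.proj (R := ℝ) (φ := fun _ : Fin 3 => ℝ) 0).comp
      (ContinuousLinearMap.snd ℝ (Fin 3 → ℝ) (Fin 3 → ℝ))
  have hl (w : (Fin 3 → ℝ) × (Fin 3 → ℝ)) :
      HasFDerivAt (fun w : (Fin 3 → ℝ) × (Fin 3 → ℝ) =>
        (α + 1) / (2 * Real.pi) * a * w.1 0 + α / (2 * Real.pi) * b * w.2 0)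
        (((α + 1) / (2 * Real.pi) * a) • L₁ + (α / (2 * Real.pi) * b) • L₂) w :=
    (L₁.hasFDerivAt.const_mul _).add (L₂.hasFDerivAt.const_mul _)
  refine ⟨fun _ p => (α + 1) / (2 * Real.pi) * a * (vec2 p).1 0 +
      α / (2 * Real.pi) * b * (vec2 p).2 0,
    fun t => Prod.map (rotX (t * a)) (rotX (t * b)),
    isHamiltonianFlow_of_coordinates ?_ ?_ ?_ ?_, by simp⟩
  · have : ContDiff ℝ ∞ (fun w : (Fin 3 → ℝ) × (Fin 3 → ℝ) =>
        (α + 1) / (2 * Real.pi) * a * w.1 0 + α / (2 * Real.pi) * b * w.2 0) := by fun_prop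
    exact this.contMDiff.comp contMDiff_vec2
  · have : ContDiff ℝ ∞ (fun q : ℝ × ((Fin 3 → ℝ) × (Fin 3 → ℝ)) =>
        ((![q.2.1 0, q.2.1 1 * Real.cos (q.1 * a) - q.2.1 2 * Real.sin (q.1 * a),
          q.2.1 1 * Real.sin (q.1 * a) + q.2.1 2 * Real.cos (q.1 * a)] : Fin 3 → ℝ),
         (![q.2.2 0, q.2.2 1 * Real.cos (q.1 * b) - q.2.2 2 * Real.sin (q.1 * b),
          q.2.2 1 * Real.sin (q.1 * b) + q.2.2 2 * Real.cos (q.1 * b)] : Fin 3 → ℝ))) := by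
      refine ContDiff.prodMk (contDiff_vec3 ?_ ?_ ?_) (contDiff_vec3 ?_ ?_ ?_) <;> fun_prop
    exact this.contMDiff.comp (contMDiff_fst.prodMk_space (contMDiff_vec2.comp contMDiff_snd))
  · rintro ⟨p, q⟩
    have h (p : S2) : rotX 0 p = p := by
      apply vec_injective
      funext i
      fin_cases i <;> simp [rotX]
    simp [h]
  · rintro t ⟨p, q⟩
    have hd (a : ℝ) (p : S2) : HasDerivAt (fun s => vec (rotX (s * a) p))
        ![0, -a * vec (rotX (t * a) p) 2, a * vec (rotX (t * a) p) 1] t := by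
      have hs : HasDerivAt (fun s => Real.sin (s * a)) (Real.cos (t * a) * a) t := by
        simpa using ((hasDerivAt_id t).mul_const a).sin
      have hc : HasDerivAt (fun s => Real.cos (s * a)) (-Real.sin (t * a) * a) t := by
        simpa using ((hasDerivAt_id t).mul_const a).cos
      simp only [rotX, vec_ofVec]
      convert! hasDerivAt_vec3 (hasDerivAt_const t (vec p 0))
        ((hc.const_mul (vec p 1)).sub (hs.const_mul (vec p 2)))
        ((hs.const_mul (vec p 1)).add (hc.const_mul (vec p 2))) using 1
      simp only [Matrix.cons_val]
      congr! 2
      · ring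
      · congr! 1
        ring
    refine ⟨_, (hl _).differentiableAt, EventuallyEq.rfl, _, (hd a p).prodMk (hd b q), ?_⟩
    intro v₁ v₂ h₁ h₂
    rw [(hl _).fderiv]
    simp only [Prod.map] at h₁ h₂ ⊢
    generalize rotX (t * a) p = p' at *
    generalize rotX (t * b) q = q' at *
    have e1 := vec_sq p'
    have e2 := vec_sq q'
    simp [ambientForm, det3, dot3, L₁, L₂] at h₁ h₂ ⊢
    linear_combination ((α + 1) / (2 * Real.pi)) * a * (-vec p' 0 * h₁ + v₁ 0 * e1) +
      α / (2 * Real.pi) * b * (-vec q' 0 * h₂ + v₂ 0 * e2)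

lemma moment_rotX (α a b : ℝ) (p : S2xS2) : moment α (Prod.map (rotX a) (rotX b) p) =
    ((1 + α) * (vec p.1 1 * Real.sin a + vec p.1 2 * Real.cos a),
      α * (vec p.2 1 * Real.sin b + vec p.2 2 * Real.cos b)) := rfl

/-! ### The circle action generated by the level, and cutting off flows that commute with it. -/

/-- The difference of the two components of the moment map, in coordinates. -/
def level (α : ℝ) (w : (Fin 3 → ℝ) × (Fin 3 → ℝ)) : ℝ := (1 + α) * w.1 2 - α * w.2 2

/-- Rotation of the first factor by the angle `g` and of the second by `-g`, about the vertical
axes. This is the flow of `level`, up to time change. -/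
def antiRot (g : ℝ) (w : (Fin 3 → ℝ) × (Fin 3 → ℝ)) : (Fin 3 → ℝ) × (Fin 3 → ℝ) :=
  (![Real.cos g * w.1 0 - Real.sin g * w.1 1, Real.sin g * w.1 0 + Real.cos g * w.1 1, w.1 2],
    ![Real.cos g * w.2 0 + Real.sin g * w.2 1, -Real.sin g * w.2 0 + Real.cos g * w.2 1, w.2 2])

/-- The generator of `antiRot`. -/
def antiRotGen (w : (Fin 3 → ℝ) × (Fin 3 → ℝ)) : (Fin 3 → ℝ) × (Fin 3 → ℝ) :=
  (![-w.1 1, w.1 0, 0], ![w.2 1, -w.2 0, 0])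

/-- The coordinates of points of `S² × S²` whose level lies in `U`. -/
def levelSet (α : ℝ) (U : Set ℝ) : Set ((Fin 3 → ℝ) × (Fin 3 → ℝ)) :=
  {w | w ∈ Set.range vec2 ∧ level α w ∈ U}

lemma vec2_injective : Function.Injective vec2 := fun _ _ h =>
  Prod.ext (vec_injective (congrArg Prod.fst h)) (vec_injective (congrArg Prod.snd h))

lemma mem_range_vec2 {w : (Fin 3 → ℝ) × (Fin 3 → ℝ)} : w ∈ Set.range vec2 ↔
    w.1 0 ^ 2 + w.1 1 ^ 2 + w.1 2 ^ 2 = 1 ∧ w.2 0 ^ 2 + w.2 1 ^ 2 + w.2 2 ^ 2 = 1 := by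
  constructor
  · rintro ⟨p, rfl⟩
    exact ⟨vec_sq p.1, vec_sq p.2⟩
  · rintro ⟨h1, h2⟩
    exact ⟨(ofVec w.1 h1, ofVec w.2 h2), rfl⟩

lemma antiRot_mem_range {w : (Fin 3 → ℝ) × (Fin 3 → ℝ)} (g : ℝ) (hw : w ∈ Set.range vec2) :
    antiRot g w ∈ Set.range vec2 := by
  rw [mem_range_vec2] at *
  have h := Real.sin_sq_add_cos_sq g
  simp only [antiRot, Matrix.cons_val]
  exact ⟨by linear_combination hw.1 + (w.1 0 ^ 2 + w.1 1 ^ 2) * h,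
    by linear_combination hw.2 + (w.2 0 ^ 2 + w.2 1 ^ 2) * h⟩

lemma level_antiRot (α g : ℝ) (w : (Fin 3 → ℝ) × (Fin 3 → ℝ)) :
    level α (antiRot g w) = level α w := by
  simp [level, antiRot]

lemma antiRot_zero (w : (Fin 3 → ℝ) × (Fin 3 → ℝ)) : antiRot 0 w = w := by
  refine Prod.ext ?_ ?_ <;> funext i <;> fin_cases i <;> simp [antiRot]

lemma contDiff_level (α : ℝ) : ContDiff ℝ ∞ (level α) := by
  unfold level
  fun_prop

lemma contDiffAt_antiRot {E : Type*} [NormedAddCommGroup E] [NormedSpace ℝ E] {f : E → ℝ}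
    {k : E → (Fin 3 → ℝ) × (Fin 3 → ℝ)} {x : E} (hf : ContDiffAt ℝ ∞ f x)
    (hk : ContDiffAt ℝ ∞ k x) : ContDiffAt ℝ ∞ (fun y => antiRot (f y) (k y)) x := by
  have h1 (i : Fin 3) : ContDiffAt ℝ ∞ (fun y => (k y).1 i) x := contDiffAt_pi.1 hk.fst i
  have h2 (i : Fin 3) : ContDiffAt ℝ ∞ (fun y => (k y).2 i) x := contDiffAt_pi.1 hk.snd i
  have hc : ContDiffAt ℝ ∞ (fun y => Real.cos (f y)) x := hf.cos
  have hs : ContDiffAt ℝ ∞ (fun y => Real.sin (f y)) x := hf.sin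
  exact ContDiffAt.prodMk
    (contDiffAt_vec3 ((hc.mul (h1 0)).sub (hs.mul (h1 1))) ((hs.mul (h1 0)).add (hc.mul (h1 1)))
      (h1 2))
    (contDiffAt_vec3 ((hc.mul (h2 0)).add (hs.mul (h2 1)))
      ((hs.neg.mul (h2 0)).add (hc.mul (h2 1))) (h2 2))

lemma hasDerivAt_antiRot {g : ℝ → ℝ} {k : ℝ → (Fin 3 → ℝ) × (Fin 3 → ℝ)} {g' t : ℝ}
    {k' : (Fin 3 → ℝ) × (Fin 3 → ℝ)} (hg : HasDerivAt g g' t) (hk : HasDerivAt k k' t) :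
    HasDerivAt (fun s => antiRot (g s) (k s))
      (g' • antiRotGen (antiRot (g t) (k t)) + antiRot (g t) k') t := by
  have h1 (i : Fin 3) : HasDerivAt (fun s => (k s).1 i) (k'.1 i) t := hasDerivAt_pi.1 hk.fst i
  have h2 (i : Fin 3) : HasDerivAt (fun s => (k s).2 i) (k'.2 i) t := hasDerivAt_pi.1 hk.snd i
  have hc := hg.cos
  have hs := hg.sin
  have H := (hasDerivAt_vec3 ((hc.mul (h1 0)).sub (hs.mul (h1 1)))
    ((hs.mul (h1 0)).add (hc.mul (h1 1))) (h1 2)).prodMk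
    (hasDerivAt_vec3 ((hc.mul (h2 0)).add (hs.mul (h2 1)))
    ((hs.neg.mul (h2 0)).add (hc.mul (h2 1))) (h2 2))
  convert! H using 1
  refine Prod.ext ?_ ?_ <;> funext i <;> fin_cases i <;> simp [antiRot, antiRotGen] <;> ring

lemma fderiv_level (α : ℝ) (w v : (Fin 3 → ℝ) × (Fin 3 → ℝ)) :
    fderiv ℝ (level α) w v = level α v := by
  apply fderiv_apply_of_hasDerivAt_line ((contDiff_level α).differentiable (by simp) w)
  have h : (fun s : ℝ => level α (w + s • v)) = fun s => level α w + s * level α v := by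
    funext s
    simp [level]
    ring
  rw [h]
  simpa using ((hasDerivAt_id (0 : ℝ)).mul_const (level α v)).const_add (level α w)

/-- The Hamiltonian field of `level` is `2π` times `antiRotGen`; the minus sign in `level` is the
opposite sense of rotation in the second factor. -/
lemma ambientForm_antiRotGen {α : ℝ} {w v : (Fin 3 → ℝ) × (Fin 3 → ℝ)}
    (hw : w ∈ Set.range vec2) (h₁ : dot3 w.1 v.1 = 0) (h₂ : dot3 w.2 v.2 = 0) :
    2 * Real.pi * ambientForm α w.1 (antiRotGen w).1 v.1 w.2 (antiRotGen w).2 v.2 =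
      level α v := by
  obtain ⟨e₁, e₂⟩ := mem_range_vec2.1 hw
  have hpi := Real.pi_ne_zero
  simp [ambientForm, antiRotGen, det3, dot3, level] at *
  field_simp
  linear_combination (α + 1) * (v.1 2 * e₁ - w.1 2 * h₁) - α * (v.2 2 * e₂ - w.2 2 * h₂)

lemma ambientForm_add_smul (α a b : ℝ) (p d e v p' d' e' v' : Fin 3 → ℝ) :
    ambientForm α p (a • d + b • e) v p' (a • d' + b • e') v' =
      a * ambientForm α p d v p' d' v' + b * ambientForm α p e v p' e' v' := by
  simp only [ambientForm, det3, Pi.add_apply, Pi.smul_apply, smul_eq_mul]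
  ring

lemma antiRot_smul (g a : ℝ) (w : (Fin 3 → ℝ) × (Fin 3 → ℝ)) :
    antiRot g (a • w) = a • antiRot g w := by
  refine Prod.ext ?_ ?_ <;> funext i <;> fin_cases i <;> simp [antiRot] <;> ring

lemma contMDiffAt_comp_vec2
    {F : ℝ × ((Fin 3 → ℝ) × (Fin 3 → ℝ)) → (Fin 3 → ℝ) × (Fin 3 → ℝ)} {t : ℝ} {p : S2xS2}
    (hF : ContDiffAt ℝ ∞ F (t, vec2 p)) :
    ContMDiffAt (𝓘(ℝ, ℝ).prod I22) (𝓘(ℝ, (Fin 3 → ℝ) × (Fin 3 → ℝ))) ∞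
      (fun q : ℝ × S2xS2 => F (q.1, vec2 q.2)) (t, p) := by
  have hg : ContMDiffAt (𝓘(ℝ, ℝ).prod I22) (𝓘(ℝ, ℝ × ((Fin 3 → ℝ) × (Fin 3 → ℝ)))) ∞
      (fun q : ℝ × S2xS2 => (q.1, vec2 q.2)) (t, p) :=
    (contMDiff_fst.prodMk_space (contMDiff_vec2.comp contMDiff_snd)).contMDiffAt
  exact ContMDiffAt.comp (t, p) hF.contMDiffAt hg

/-- The flow `K` of a Hamiltonian `h` which is defined on a range `U` of levels and which commutes
with `level` can be cut off by a function `χ` of the level. -/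
theorem exists_cutoff_flow {α : ℝ} {U C : Set ℝ} (hU : IsOpen U) (hC : IsClosed C) (hCU : C ⊆ U)
    {h : (Fin 3 → ℝ) × (Fin 3 → ℝ) → ℝ}
    {K : ℝ → (Fin 3 → ℝ) × (Fin 3 → ℝ) → (Fin 3 → ℝ) × (Fin 3 → ℝ)}
    {X : (Fin 3 → ℝ) × (Fin 3 → ℝ) → (Fin 3 → ℝ) × (Fin 3 → ℝ)}
    (hh : ∀ w ∈ levelSet α U, ContDiffAt ℝ ∞ h w)
    (hK : ∀ b, ∀ w ∈ levelSet α U, ContDiffAt ℝ ∞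
      (fun q : ℝ × ((Fin 3 → ℝ) × (Fin 3 → ℝ)) => K q.1 q.2) (b, w))
    (hK0 : ∀ w ∈ levelSet α U, K 0 w = w)
    (hKr : ∀ b, ∀ w ∈ levelSet α U, K b w ∈ Set.range vec2)
    (hKl : ∀ b, ∀ w ∈ levelSet α U, level α (K b w) = level α w)
    (hKh : ∀ b, ∀ w ∈ levelSet α U, h (K b w) = h w)
    (hKX : ∀ b, ∀ w ∈ levelSet α U, HasDerivAt (fun s => K s w) (X (K b w)) b)
    (hGh : ∀ g, ∀ w ∈ levelSet α U, h (antiRot g w) = h w)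
    (hGX : ∀ g, ∀ w ∈ levelSet α U, X (antiRot g w) = antiRot g (X w))
    (hX : ∀ w ∈ levelSet α U, ∀ v, dot3 w.1 v.1 = 0 → dot3 w.2 v.2 = 0 →
      ambientForm α w.1 (X w).1 v.1 w.2 (X w).2 v.2 = fderiv ℝ h w v)
    {χ : ℝ → ℝ} (hχ : ContDiff ℝ ∞ χ) (hχC : ∀ c ∉ C, χ c = 0) :
    ∃ ψ ∈ Ham α, (∀ p, level α (vec2 p) ∉ U → ψ p = p) ∧
      ∀ p, level α (vec2 p) ∈ U →
        ∃ g, vec2 (ψ p) = antiRot g (K (χ (level α (vec2 p))) (vec2 p)) := by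
  classical
  have hχ' : ContDiff ℝ ∞ (deriv χ) := (contDiff_infty_iff_deriv.1 hχ).2
  have hχC' (c : ℝ) (hc : c ∉ C) : deriv χ c = 0 := by
    have : χ =ᶠ[𝓝 c] fun _ => 0 := by
      filter_upwards [hC.isOpen_compl.mem_nhds hc] with s hs using hχC s hs
    rw [this.deriv_eq, deriv_const]
  have hcont : Continuous fun p : S2xS2 => level α (vec2 p) :=
    (contDiff_level α).continuous.comp contMDiff_vec2.continuous
  -- By the product rule the field of `χ(level) * h` is `χ X + χ' h` times the field of `level`. The
  -- coefficients are constant along the motion and the two fields commute, so the flow is the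
  -- composition of the two flows, each with its time rescaled.
  let F : ℝ → (Fin 3 → ℝ) × (Fin 3 → ℝ) → (Fin 3 → ℝ) × (Fin 3 → ℝ) := fun t w =>
    antiRot (t * (2 * Real.pi * (deriv χ (level α w) * h w))) (K (t * χ (level α w)) w)
  have hFr (t : ℝ) {w} (hw : w ∈ levelSet α U) : F t w ∈ Set.range vec2 :=
    antiRot_mem_range _ (hKr _ w hw)
  have hFl (t : ℝ) {w} (hw : w ∈ levelSet α U) : level α (F t w) = level α w := by
    simp only [F]
    rw [level_antiRot, hKl _ w hw]
  have hK_mem (b : ℝ) {w} (hw : w ∈ levelSet α U) : K b w ∈ levelSet α U :=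
    ⟨hKr b w hw, by rw [hKl b w hw]; exact hw.2⟩
  have hF0 (t : ℝ) {w} (hw : w ∈ levelSet α U) (hc : level α w ∉ C) : F t w = w := by
    simp only [F]
    rw [hχC _ hc, hχC' _ hc]
    simp only [zero_mul, mul_zero]
    rw [antiRot_zero, hK0 w hw]
  -- The flow is `F` over `U` and the identity over the complement of `C`. These open sets cover,
  -- and on their overlap both prescriptions agree by `hF0`.
  have hex (t : ℝ) (p : S2xS2) : ∃ q : S2xS2,
      (level α (vec2 p) ∉ C → q = p) ∧ (level α (vec2 p) ∈ U → vec2 q = F t (vec2 p)) := by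
    by_cases hp : level α (vec2 p) ∈ U
    · have hw : vec2 p ∈ levelSet α U := ⟨⟨p, rfl⟩, hp⟩
      obtain ⟨q, hq⟩ := hFr t hw
      exact ⟨q, fun hc => vec2_injective (hq.trans (hF0 t hw hc)), fun _ => hq⟩
    · exact ⟨p, fun _ => rfl, fun h => absurd h hp⟩
  choose φ hφC hφU using hex
  have hnotC {p : S2xS2} (hp : level α (vec2 p) ∉ U) : level α (vec2 p) ∉ C := fun h => hp (hCU h)
  have hHs (w) (hw : w ∈ levelSet α U) : ContDiffAt ℝ ∞ (fun w => χ (level α w) * h w) w :=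
    (hχ.comp (contDiff_level α)).contDiffAt.mul (hh w hw)
  refine ⟨φ 1, ⟨fun _ p => χ (level α (vec2 p)) * h (vec2 p), φ,
    isHamiltonianFlow_of_coordinates ?_ ?_ ?_ ?_, rfl⟩, fun p hp => hφC 1 p (hnotC hp),
    fun p hp => ⟨_, by rw [hφU 1 p hp]; simp only [F, one_mul]; rfl⟩⟩
  · intro p
    by_cases hp : level α (vec2 p) ∈ U
    · exact (hHs (vec2 p) ⟨⟨p, rfl⟩, hp⟩).contMDiffAt.comp p contMDiff_vec2.contMDiffAt
    · refine (contMDiffAt_const (c := (0 : ℝ))).congr_of_eventuallyEq ?_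
      filter_upwards [(hC.isOpen_compl.preimage hcont).mem_nhds (hnotC hp)] with q hq
      rw [hχC _ hq, zero_mul]
  · rintro ⟨t, p⟩
    by_cases hp : level α (vec2 p) ∈ U
    · have hw : vec2 p ∈ levelSet α U := ⟨⟨p, rfl⟩, hp⟩
      have hF : ContDiffAt ℝ ∞ (fun q : ℝ × ((Fin 3 → ℝ) × (Fin 3 → ℝ)) => F q.1 q.2)
          (t, vec2 p) := by
        have hl : ContDiffAt ℝ ∞ (fun q : ℝ × ((Fin 3 → ℝ) × (Fin 3 → ℝ)) => level α q.2)
            (t, vec2 p) := ((contDiff_level α).comp contDiff_snd).contDiffAt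
        have hh' : ContDiffAt ℝ ∞ (fun q : ℝ × ((Fin 3 → ℝ) × (Fin 3 → ℝ)) => h q.2)
            (t, vec2 p) := (hh (vec2 p) hw).comp (t, vec2 p) contDiffAt_snd
        have h1 : ContDiffAt ℝ ∞ (fun q : ℝ × ((Fin 3 → ℝ) × (Fin 3 → ℝ)) =>
            q.1 * (2 * Real.pi * (deriv χ (level α q.2) * h q.2))) (t, vec2 p) :=
          contDiffAt_fst.mul (contDiffAt_const.mul ((hχ'.contDiffAt.comp _ hl).mul hh'))
        have h2 : ContDiffAt ℝ ∞ (fun q : ℝ × ((Fin 3 → ℝ) × (Fin 3 → ℝ)) =>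
            (q.1 * χ (level α q.2), q.2)) (t, vec2 p) :=
          (contDiffAt_fst.mul (hχ.contDiffAt.comp _ hl)).prodMk contDiffAt_snd
        have h3 := (hK (t * χ (level α (vec2 p))) (vec2 p) hw).comp (t, vec2 p) h2
        exact contDiffAt_antiRot h1 h3
      refine (contMDiffAt_comp_vec2 hF).congr_of_eventuallyEq ?_
      filter_upwards [((hU.preimage hcont).preimage continuous_snd).mem_nhds
        (show (t, p) ∈ Prod.snd ⁻¹' ((fun p : S2xS2 => level α (vec2 p)) ⁻¹' U) from hp)] with q hq
      exact hφU q.1 q.2 hq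
    · refine (contMDiff_vec2.comp contMDiff_snd).contMDiffAt.congr_of_eventuallyEq ?_
      filter_upwards [((hC.isOpen_compl.preimage hcont).preimage continuous_snd).mem_nhds
        (show (t, p) ∈ Prod.snd ⁻¹' ((fun p : S2xS2 => level α (vec2 p)) ⁻¹' Cᶜ)
          from hnotC hp)] with q hq
      exact congrArg vec2 (hφC q.1 q.2 hq)
  · intro p
    by_cases hp : level α (vec2 p) ∈ U
    · have hw : vec2 p ∈ levelSet α U := ⟨⟨p, rfl⟩, hp⟩
      apply vec2_injective
      rw [hφU 0 p hp]
      simp only [F, zero_mul]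
      rw [antiRot_zero, hK0 _ hw]
    · exact hφC 0 p (hnotC hp)
  · intro t p
    by_cases hp : level α (vec2 p) ∈ U
    · have hw : vec2 p ∈ levelSet α U := ⟨⟨p, rfl⟩, hp⟩
      have hφ (s : ℝ) : vec2 (φ s p) = F s (vec2 p) := hφU s p hp
      have hw' : vec2 (φ t p) ∈ levelSet α U :=
        ⟨⟨_, rfl⟩, by rw [hφ, hFl t hw]; exact hp⟩
      have hlev : level α (vec2 (φ t p)) = level α (vec2 p) := by rw [hφ, hFl t hw]
      have hhF : h (vec2 (φ t p)) = h (vec2 p) := by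
        rw [hφ]
        simp only [F]
        rw [hGh _ _ (hK_mem _ hw), hKh _ _ hw]
      refine ⟨fun w => χ (level α w) * h w, (hHs _ hw').differentiableAt (by simp),
        EventuallyEq.rfl,
        (2 * Real.pi * (deriv χ (level α (vec2 p)) * h (vec2 p))) • antiRotGen (vec2 (φ t p)) +
          χ (level α (vec2 p)) • X (vec2 (φ t p)), ?_, ?_⟩
      · have h1 : HasDerivAt (fun s : ℝ => s * (2 * Real.pi *
            (deriv χ (level α (vec2 p)) * h (vec2 p))))
            (2 * Real.pi * (deriv χ (level α (vec2 p)) * h (vec2 p))) t := by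
          simpa using (hasDerivAt_id t).mul_const _
        have h2 : HasDerivAt (fun s : ℝ => s * χ (level α (vec2 p))) (χ (level α (vec2 p))) t := by
          simpa using (hasDerivAt_id t).mul_const (χ (level α (vec2 p)))
        have h3 := hasDerivAt_antiRot h1
          ((hKX (t * χ (level α (vec2 p))) (vec2 p) hw).scomp t h2)
        convert! h3 using 1
        · funext s
          exact hφ s
        · rw [antiRot_smul, ← hGX _ _ (hK_mem _ hw), hφ]
          rfl
      · intro v₁ v₂ h₁ h₂
        have hd : fderiv ℝ (fun w => χ (level α w) * h w) (vec2 (φ t p)) =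
            χ (level α (vec2 (φ t p))) • fderiv ℝ h (vec2 (φ t p)) +
              h (vec2 (φ t p)) • (deriv χ (level α (vec2 (φ t p))) •
                fderiv ℝ (level α) (vec2 (φ t p))) := by
          have hl := ((contDiff_level α).differentiable (by simp) (vec2 (φ t p))).hasFDerivAt
          have hx := (hχ.differentiable (by simp) (level α (vec2 (φ t p)))).hasDerivAt
          have hf := ((hh _ hw').differentiableAt (by simp)).hasFDerivAt
          exact ((hx.comp_hasFDerivAt _ hl).mul hf).fderiv
        rw [hd]
        have e1 := hX _ hw' (v₁, v₂) h₁ h₂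
        have e2 := ambientForm_antiRotGen (α := α) (v := (v₁, v₂)) hw'.1 h₁ h₂
        simp only [vec2] at e1 e2
        simp only [Prod.fst_add, Prod.snd_add, Prod.smul_fst, Prod.smul_snd,
          ambientForm_add_smul, add_apply, smul_apply,
          smul_eq_mul, fderiv_level, hlev, hhF]
        simp only [vec2]
        rw [e1, ← e2]
        ring
    · have hφ (s : ℝ) : φ s p = p := hφC s p (hnotC hp)
      refine ⟨fun _ => 0, differentiableAt_const _, ?_, 0, ?_, ?_⟩
      · rw [hφ]
        filter_upwards [(hC.isOpen_compl.preimage hcont).mem_nhds (hnotC hp)] with q hq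
        rw [hχC _ hq, zero_mul]
      · simp only [hφ]
        exact hasDerivAt_const _ _
      · intro v₁ v₂ _ _
        simp [ambientForm, det3]

/-! ### The flip of the levels between `-1` and `1` -/

/-- The distance of the first point to the vertical axis. -/
def rad (w : (Fin 3 → ℝ) × (Fin 3 → ℝ)) : ℝ := √(1 - w.1 2 ^ 2)

/-- The real part of the second point in the frame that rotates with the first. -/
def frameRe (w : (Fin 3 → ℝ) × (Fin 3 → ℝ)) : ℝ := (w.1 0 * w.2 0 - w.1 1 * w.2 1) / rad w

/-- The imaginary part of the second point in the frame that rotates with the first. -/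
def frameIm (w : (Fin 3 → ℝ) × (Fin 3 → ℝ)) : ℝ := (w.1 0 * w.2 1 + w.1 1 * w.2 0) / rad w

/-- The Hamiltonian of `midFlow`. -/
def midHam (α : ℝ) (w : (Fin 3 → ℝ) × (Fin 3 → ℝ)) : ℝ := α / (2 * Real.pi) * frameRe w

/-- The height of the first point along `midFlow`. -/
def midHeight (α b : ℝ) (w : (Fin 3 → ℝ) × (Fin 3 → ℝ)) : ℝ :=
  w.1 2 + α / (1 + α) * (w.2 2 * Real.cos b + frameIm w * Real.sin b - w.2 2)

/-- The rotation of the second point in the frame that rotates with the first, with a compensating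
change of height of the first point. -/
def midFlow (α b : ℝ) (w : (Fin 3 → ℝ) × (Fin 3 → ℝ)) : (Fin 3 → ℝ) × (Fin 3 → ℝ) :=
  (![√(1 - midHeight α b w ^ 2) / rad w * w.1 0, √(1 - midHeight α b w ^ 2) / rad w * w.1 1,
      midHeight α b w],
    ![(w.1 0 * frameRe w + w.1 1 * (frameIm w * Real.cos b - w.2 2 * Real.sin b)) / rad w,
      (w.1 0 * (frameIm w * Real.cos b - w.2 2 * Real.sin b) - w.1 1 * frameRe w) / rad w,
      w.2 2 * Real.cos b + frameIm w * Real.sin b])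

/-- The vector field of `midFlow`. -/
def midField (α : ℝ) (w : (Fin 3 → ℝ) × (Fin 3 → ℝ)) : (Fin 3 → ℝ) × (Fin 3 → ℝ) :=
  (![-(w.1 2 * (α / (1 + α) * frameIm w) / rad w ^ 2) * w.1 0,
      -(w.1 2 * (α / (1 + α) * frameIm w) / rad w ^ 2) * w.1 1, α / (1 + α) * frameIm w],
    ![-(w.2 2 * w.1 1) / rad w, -(w.2 2 * w.1 0) / rad w, frameIm w])

/-- At these levels the first point avoids the poles, so its longitude supplies the frame for the
second point. -/
lemma sq_lt_one_of_level {α Z₁ Z₂ : ℝ} (hα : 0 < α) (h : |(1 + α) * Z₁ - α * Z₂| < 1)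
    (h₂ : Z₂ ^ 2 ≤ 1) : 0 < 1 - Z₁ ^ 2 := by
  obtain ⟨ha, hb⟩ := abs_lt.1 h
  obtain ⟨hc, hd⟩ := abs_le.1 (abs_le_one_iff_mul_self_le_one.2 (by linarith [sq Z₂]) : |Z₂| ≤ 1)
  have h1 : Z₁ < 1 := by nlinarith
  have h2 : -1 < Z₁ := by nlinarith
  nlinarith

/-- The relations between the coordinates used below. -/
lemma mid_relations {α : ℝ} (hα : 0 < α) {w : (Fin 3 → ℝ) × (Fin 3 → ℝ)}
    (hw : w ∈ levelSet α (Set.Ioo (-1) 1)) :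
    0 < 1 - w.1 2 ^ 2 ∧ 0 < rad w ∧ rad w ^ 2 = 1 - w.1 2 ^ 2 ∧
      w.1 0 ^ 2 + w.1 1 ^ 2 = rad w ^ 2 ∧ frameRe w ^ 2 + frameIm w ^ 2 + w.2 2 ^ 2 = 1 := by
  obtain ⟨hr, hl⟩ := hw
  obtain ⟨e₁, e₂⟩ := mem_range_vec2.1 hr
  have h1 : 0 < 1 - w.1 2 ^ 2 := sq_lt_one_of_level hα (abs_lt.2 hl)
    (by nlinarith [sq_nonneg (w.2 0), sq_nonneg (w.2 1)])
  have h2 : 0 < rad w := Real.sqrt_pos.2 h1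
  have h3 : rad w ^ 2 = 1 - w.1 2 ^ 2 := Real.sq_sqrt h1.le
  have h4 : w.1 0 ^ 2 + w.1 1 ^ 2 = rad w ^ 2 := by linarith
  refine ⟨h1, h2, h3, h4, ?_⟩
  rw [frameRe, frameIm]
  field_simp
  linear_combination (w.2 0 ^ 2 + w.2 1 ^ 2) * h4 + rad w ^ 2 * e₂

lemma level_midFlow {α : ℝ} (hα : 0 < α) (b : ℝ) (w : (Fin 3 → ℝ) × (Fin 3 → ℝ)) :
    level α (midFlow α b w) = level α w := by
  have : 1 + α ≠ 0 := by positivity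
  simp [level, midFlow, midHeight]
  field_simp
  ring

lemma midHeight_sq_lt {α : ℝ} (hα : 0 < α) (b : ℝ) {w : (Fin 3 → ℝ) × (Fin 3 → ℝ)}
    (hw : w ∈ levelSet α (Set.Ioo (-1) 1)) : 0 < 1 - midHeight α b w ^ 2 := by
  obtain ⟨-, -, -, -, h5⟩ := mid_relations hα hw
  have h6 := level_midFlow hα b w
  have h7 := hw.2
  rw [← h6] at h7
  have hb := Real.sin_sq_add_cos_sq b
  -- The new pair of heights has the same level, and the second height is still at most `1` in
  -- modulus, being a coordinate of a rotated unit vector.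
  refine sq_lt_one_of_level hα (Z₂ := w.2 2 * Real.cos b + frameIm w * Real.sin b)
    (abs_lt.2 h7) ?_
  nlinarith [sq_nonneg (frameRe w), sq_nonneg (w.2 2 * Real.sin b - frameIm w * Real.cos b)]

lemma midFlow_mem_range {α : ℝ} (hα : 0 < α) (b : ℝ) {w : (Fin 3 → ℝ) × (Fin 3 → ℝ)}
    (hw : w ∈ levelSet α (Set.Ioo (-1) 1)) : midFlow α b w ∈ Set.range vec2 := by
  obtain ⟨-, h2, -, h4, h5⟩ := mid_relations hα hw
  have h6 := Real.sq_sqrt (midHeight_sq_lt hα b hw).le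
  have hb := Real.sin_sq_add_cos_sq b
  rw [mem_range_vec2]
  simp only [midFlow, Matrix.cons_val]
  generalize √(1 - midHeight α b w ^ 2) = s at *
  generalize midHeight α b w = Z at *
  generalize rad w = r at *
  generalize frameRe w = u at *
  generalize frameIm w = v at *
  constructor
  · field_simp
    linear_combination s ^ 2 * h4 + r ^ 2 * h6
  · field_simp
    linear_combination (u ^ 2 + (v * Real.cos b - w.2 2 * Real.sin b) ^ 2) * h4 +
      r ^ 2 * h5 + r ^ 2 * (v ^ 2 + w.2 2 ^ 2) * hb

lemma rad_midFlow (α b : ℝ) (w : (Fin 3 → ℝ) × (Fin 3 → ℝ)) :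
    rad (midFlow α b w) = √(1 - midHeight α b w ^ 2) := rfl

/-- `frameRe`, `frameIm` and the second height are coordinates on the reduced sphere. The flow
rotates it about the `frameRe` axis, so its Hamiltonian is conserved. -/
lemma frameRe_midFlow {α : ℝ} (hα : 0 < α) (b : ℝ) {w : (Fin 3 → ℝ) × (Fin 3 → ℝ)}
    (hw : w ∈ levelSet α (Set.Ioo (-1) 1)) : frameRe (midFlow α b w) = frameRe w := by
  obtain ⟨-, h2, -, h4, -⟩ := mid_relations hα hw
  have h6 := Real.sqrt_pos.2 (midHeight_sq_lt hα b hw)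
  rw [frameRe, rad_midFlow]
  simp only [midFlow, Matrix.cons_val]
  generalize √(1 - midHeight α b w ^ 2) = s at *
  generalize rad w = r at *
  generalize frameRe w = u at *
  generalize frameIm w = v at *
  field_simp
  linear_combination u * h4

lemma frameIm_midFlow {α : ℝ} (hα : 0 < α) (b : ℝ) {w : (Fin 3 → ℝ) × (Fin 3 → ℝ)}
    (hw : w ∈ levelSet α (Set.Ioo (-1) 1)) :
    frameIm (midFlow α b w) = frameIm w * Real.cos b - w.2 2 * Real.sin b := by
  obtain ⟨-, h2, -, h4, -⟩ := mid_relations hα hw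
  have h6 := Real.sqrt_pos.2 (midHeight_sq_lt hα b hw)
  rw [frameIm, rad_midFlow]
  simp only [midFlow, Matrix.cons_val]
  generalize √(1 - midHeight α b w ^ 2) = s at *
  generalize rad w = r at *
  generalize frameRe w = u at *
  generalize frameIm w = v at *
  field_simp
  linear_combination (v * Real.cos b - w.2 2 * Real.sin b) * h4

lemma midFlow_zero {α : ℝ} (hα : 0 < α) {w : (Fin 3 → ℝ) × (Fin 3 → ℝ)}
    (hw : w ∈ levelSet α (Set.Ioo (-1) 1)) : midFlow α 0 w = w := by
  obtain ⟨-, h2, h3, h4, -⟩ := mid_relations hα hw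
  have hz : midHeight α 0 w = w.1 2 := by simp [midHeight]
  have hs : √(1 - w.1 2 ^ 2) = rad w := rfl
  have h2' := h2.ne'
  refine Prod.ext ?_ ?_ <;> funext i <;> fin_cases i
  · simp [midFlow, hz, hs, h2']
  · simp [midFlow, hz, hs, h2']
  · simp [midFlow, hz]
  · simp [midFlow, frameRe, frameIm]
    field_simp
    linear_combination w.2 0 * h4
  · simp [midFlow, frameRe, frameIm]
    field_simp
    linear_combination w.2 1 * h4
  · simp [midFlow]

lemma contDiffAt_rad {w : (Fin 3 → ℝ) × (Fin 3 → ℝ)} (hw : 0 < 1 - w.1 2 ^ 2) :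
    ContDiffAt ℝ ∞ rad w := by
  unfold rad
  exact ContDiffAt.sqrt (by fun_prop) hw.ne'

lemma contDiffAt_frameRe {w : (Fin 3 → ℝ) × (Fin 3 → ℝ)} (hw : 0 < 1 - w.1 2 ^ 2) :
    ContDiffAt ℝ ∞ frameRe w :=
  ContDiffAt.div (by fun_prop) (contDiffAt_rad hw) (Real.sqrt_pos.2 hw).ne'

lemma contDiffAt_frameIm {w : (Fin 3 → ℝ) × (Fin 3 → ℝ)} (hw : 0 < 1 - w.1 2 ^ 2) :
    ContDiffAt ℝ ∞ frameIm w :=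
  ContDiffAt.div (by fun_prop) (contDiffAt_rad hw) (Real.sqrt_pos.2 hw).ne'

lemma contDiffAt_midFlow {α : ℝ} (hα : 0 < α) (b : ℝ) {w : (Fin 3 → ℝ) × (Fin 3 → ℝ)}
    (hw : w ∈ levelSet α (Set.Ioo (-1) 1)) : ContDiffAt ℝ ∞
      (fun q : ℝ × ((Fin 3 → ℝ) × (Fin 3 → ℝ)) => midFlow α q.1 q.2) (b, w) := by
  obtain ⟨h1, h2, -, -, -⟩ := mid_relations hα hw
  have hr : ContDiffAt ℝ ∞ (fun q : ℝ × ((Fin 3 → ℝ) × (Fin 3 → ℝ)) => rad q.2) (b, w) :=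
    ContDiffAt.comp (g := rad) (f := Prod.snd) (b, w) (contDiffAt_rad h1) contDiffAt_snd
  have hu : ContDiffAt ℝ ∞ (fun q : ℝ × ((Fin 3 → ℝ) × (Fin 3 → ℝ)) => frameRe q.2) (b, w) :=
    ContDiffAt.comp (g := frameRe) (f := Prod.snd) (b, w) (contDiffAt_frameRe h1) contDiffAt_snd
  have hv : ContDiffAt ℝ ∞ (fun q : ℝ × ((Fin 3 → ℝ) × (Fin 3 → ℝ)) => frameIm q.2) (b, w) :=
    ContDiffAt.comp (g := frameIm) (f := Prod.snd) (b, w) (contDiffAt_frameIm h1) contDiffAt_snd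
  have hz : ContDiffAt ℝ ∞ (fun q : ℝ × ((Fin 3 → ℝ) × (Fin 3 → ℝ)) => midHeight α q.1 q.2)
      (b, w) := by
    unfold midHeight
    fun_prop
  have hs : ContDiffAt ℝ ∞ (fun q : ℝ × ((Fin 3 → ℝ) × (Fin 3 → ℝ)) =>
      √(1 - midHeight α q.1 q.2 ^ 2)) (b, w) :=
    ContDiffAt.sqrt (by fun_prop) (midHeight_sq_lt hα b hw).ne'
  have h2' : rad (b, w).2 ≠ 0 := h2.ne'
  refine ContDiffAt.prodMk (contDiffAt_vec3 ?_ ?_ hz) (contDiffAt_vec3 ?_ ?_ ?_)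
  · exact (hs.div hr h2').mul (by fun_prop)
  · exact (hs.div hr h2').mul (by fun_prop)
  · exact ContDiffAt.div (by fun_prop) hr h2'
  · exact ContDiffAt.div (by fun_prop) hr h2'
  · fun_prop

lemma hasDerivAt_midFlow {α : ℝ} (hα : 0 < α) (b : ℝ) {w : (Fin 3 → ℝ) × (Fin 3 → ℝ)}
    (hw : w ∈ levelSet α (Set.Ioo (-1) 1)) :
    HasDerivAt (fun s => midFlow α s w) (midField α (midFlow α b w)) b := by
  obtain ⟨h1, h2, -, -, -⟩ := mid_relations hα hw
  have h3 := midHeight_sq_lt hα b hw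
  have hc := Real.hasDerivAt_cos b
  have hs := Real.hasDerivAt_sin b
  have hY : HasDerivAt (fun s => w.2 2 * Real.cos s + frameIm w * Real.sin s)
      (w.2 2 * -Real.sin b + frameIm w * Real.cos b) b :=
    (hc.const_mul (w.2 2)).add (hs.const_mul (frameIm w))
  have hV : HasDerivAt (fun s => frameIm w * Real.cos s - w.2 2 * Real.sin s)
      (frameIm w * -Real.sin b - w.2 2 * Real.cos b) b :=
    (hc.const_mul (frameIm w)).sub (hs.const_mul (w.2 2))
  have hZ : HasDerivAt (fun s => midHeight α s w)
      (α / (1 + α) * (w.2 2 * -Real.sin b + frameIm w * Real.cos b)) b :=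
    ((hY.sub_const (w.2 2)).const_mul (α / (1 + α))).const_add (w.1 2)
  have hS := ((hZ.fun_pow 2).const_sub 1).sqrt h3.ne'
  have H := (hasDerivAt_vec3 ((hS.div_const (rad w)).mul_const (w.1 0))
    ((hS.div_const (rad w)).mul_const (w.1 1)) hZ).prodMk
    (hasDerivAt_vec3 (((hV.const_mul (w.1 1)).const_add (w.1 0 * frameRe w)).div_const (rad w))
      (((hV.const_mul (w.1 0)).sub_const (w.1 1 * frameRe w)).div_const (rad w)) hY)
  convert! H using 1
  have h4 := Real.sqrt_pos.2 h3
  have h5 := Real.sq_sqrt h3.le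
  rw [midField, frameIm_midFlow hα b hw, rad_midFlow]
  simp only [midFlow, Matrix.cons_val]
  generalize √(1 - midHeight α b w ^ 2) = s at *
  generalize midHeight α b w = Z at *
  generalize rad w = r at *
  generalize frameRe w = u at *
  generalize frameIm w = v at *
  have : 1 + α ≠ 0 := by positivity
  refine Prod.ext ?_ ?_ <;> funext i <;> fin_cases i <;>
    simp [-mul_eq_mul_left_iff, -mul_eq_mul_right_iff] <;> field_simp <;> ring

lemma frameRe_antiRot (g : ℝ) (w : (Fin 3 → ℝ) × (Fin 3 → ℝ)) :
    frameRe (antiRot g w) = frameRe w := by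
  have h := Real.sin_sq_add_cos_sq g
  have hr : rad (antiRot g w) = rad w := rfl
  rw [frameRe, frameRe, hr]
  congr 1
  simp only [antiRot, Matrix.cons_val]
  linear_combination (w.1 0 * w.2 0 - w.1 1 * w.2 1) * h

lemma frameIm_antiRot (g : ℝ) (w : (Fin 3 → ℝ) × (Fin 3 → ℝ)) :
    frameIm (antiRot g w) = frameIm w := by
  have h := Real.sin_sq_add_cos_sq g
  have hr : rad (antiRot g w) = rad w := rfl
  rw [frameIm, frameIm, hr]
  congr 1
  simp only [antiRot, Matrix.cons_val]
  linear_combination (w.1 0 * w.2 1 + w.1 1 * w.2 0) * h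

lemma midField_antiRot (α g : ℝ) (w : (Fin 3 → ℝ) × (Fin 3 → ℝ)) :
    midField α (antiRot g w) = antiRot g (midField α w) := by
  have hr : rad (antiRot g w) = rad w := rfl
  rw [midField, frameIm_antiRot, hr, midField]
  refine Prod.ext ?_ ?_ <;> funext i <;> fin_cases i <;> simp [antiRot] <;> ring

lemma ambientForm_midField {α : ℝ} (hα : 0 < α) {w : (Fin 3 → ℝ) × (Fin 3 → ℝ)}
    (hw : w ∈ levelSet α (Set.Ioo (-1) 1)) (v : (Fin 3 → ℝ) × (Fin 3 → ℝ))
    (hv₁ : dot3 w.1 v.1 = 0) (hv₂ : dot3 w.2 v.2 = 0) :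
    ambientForm α w.1 (midField α w).1 v.1 w.2 (midField α w).2 v.2 =
      fderiv ℝ (midHam α) w v := by
  obtain ⟨h1, h2, h3, h4, h5⟩ := mid_relations hα hw
  obtain ⟨-, e₂⟩ := mem_range_vec2.1 hw.1
  have hl (a b : ℝ) : HasDerivAt (fun s : ℝ => a + s * b) b 0 := by
    simpa using ((hasDerivAt_id (0 : ℝ)).mul_const b).const_add a
  have hr : HasDerivAt (fun s : ℝ => √(1 - (w.1 2 + s * v.1 2) ^ 2))
      (-(w.1 2 * v.1 2) / rad w) 0 := by
    have := (((hl (w.1 2) (v.1 2)).fun_pow 2).const_sub 1).sqrt (by simpa using h1.ne')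
    convert! this using 1
    simp [rad]
    ring
  have hF : HasDerivAt (fun s : ℝ => midHam α (w + s • v)) (α / (2 * Real.pi) *
      (((v.1 0 * w.2 0 + w.1 0 * v.2 0 - (v.1 1 * w.2 1 + w.1 1 * v.2 1)) * rad w -
        (w.1 0 * w.2 0 - w.1 1 * w.2 1) * (-(w.1 2 * v.1 2) / rad w)) / rad w ^ 2)) 0 := by
    have := (((((hl (w.1 0) (v.1 0)).mul (hl (w.2 0) (v.2 0))).sub
      ((hl (w.1 1) (v.1 1)).mul (hl (w.2 1) (v.2 1)))).div hr
        (by simpa using (Real.sqrt_pos.2 h1).ne'))).const_mul (α / (2 * Real.pi))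
    convert! this using 1
    simp [rad]
  rw [fderiv_apply_of_hasDerivAt_line ?_ hF]
  · simp only [ambientForm, midField, frameIm, det3, dot3, Matrix.cons_val] at *
    clear hF hr hl
    clear hw h5
    generalize rad w = r at *
    generalize w.1 0 = x₁ at *
    generalize w.1 1 = y₁ at *
    generalize w.1 2 = z₁ at *
    -- Writing the horizontal part of the first point as `r` times a unit vector `(a, b)` turns the
    -- claim into a polynomial identity modulo the sphere and tangency relations.
    obtain ⟨a, rfl⟩ : ∃ a, x₁ = r * a := ⟨x₁ / r, by field_simp⟩
    obtain ⟨b, rfl⟩ : ∃ b, y₁ = r * b := ⟨y₁ / r, by field_simp⟩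
    have hab : a ^ 2 + b ^ 2 = 1 := by
      have : r ^ 2 ≠ 0 := by positivity
      apply mul_left_cancel₀ this
      linear_combination h4
    have hpi := Real.pi_ne_zero
    have : 1 + α ≠ 0 := by positivity
    have : α + 1 ≠ 0 := by positivity
    field_simp
    linear_combination (1 + α) *
      (r * (a * w.2 1 + b * w.2 0) * (b * v.1 0 - a * v.1 1) * h3 +
        r * (w.2 0 * v.1 0 - w.2 1 * v.1 1) * hab - (a * w.2 0 - b * w.2 1) * hv₁ +
        r ^ 2 * ((a * v.2 0 - b * v.2 1) * e₂ - (a * w.2 0 - b * w.2 1) * hv₂))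
  · exact (contDiffAt_const.mul (contDiffAt_frameRe h1)).differentiableAt (by simp)

/-- The flip of the levels between `-1` and `1`. -/
theorem exists_mid_flip {α δ : ℝ} (hα : 0 < α) (hδ : 0 < δ) : ∃ ψ ∈ Ham α,
    (∀ p, 1 ≤ |level α (vec2 p)| → ψ p = p) ∧
    ∀ p, level α (vec2 p) ^ 2 ≤ 1 - 2 * δ → moment α (ψ p) =
      ((moment α p).1 - 2 * (moment α p).2, -(moment α p).2) := by
  -- A half-turn where `c ^ 2 ≤ 1 - 2δ`, and no motion where `c ^ 2 ≥ 1 - δ`.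
  let χ : ℝ → ℝ := fun c => Real.pi * Real.smoothTransition ((1 - δ - c ^ 2) / δ)
  have hχ : ContDiff ℝ ∞ χ :=
    contDiff_const.mul (Real.smoothTransition.contDiff.comp (by fun_prop))
  obtain ⟨ψ, hψ, h1, h2⟩ := exists_cutoff_flow (α := α) (U := Set.Ioo (-1) 1)
    (C := {c | c ^ 2 ≤ 1 - δ}) isOpen_Ioo
    (isClosed_le (by fun_prop) (by fun_prop))
    (fun c (hc : c ^ 2 ≤ 1 - δ) => abs_lt.1 ((sq_lt_one_iff_abs_lt_one c).1 (by linarith)))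
    (fun w hw => contDiffAt_const.mul (contDiffAt_frameRe (mid_relations hα hw).1))
    (fun b w hw => contDiffAt_midFlow hα b hw) (fun w hw => midFlow_zero hα hw)
    (fun b w hw => midFlow_mem_range hα b hw) (fun b w _ => level_midFlow hα b w)
    (fun b w hw => by simp only [frameRe_midFlow hα b hw])
    (fun b w hw => hasDerivAt_midFlow hα b hw)
    (fun g w _ => by simp only [frameRe_antiRot])
    (fun g w _ => midField_antiRot α g w)
    (fun w hw v => ambientForm_midField hα hw v) hχ
    (fun c hc => by
      have : 1 - δ < c ^ 2 := not_le.1 hc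
      simp only [χ]
      rw [Real.smoothTransition.zero_of_nonpos, mul_zero]
      exact div_nonpos_of_nonpos_of_nonneg (by linarith) hδ.le)
  refine ⟨ψ, hψ, fun p hp => h1 p fun h => ?_, fun p hp => ?_⟩
  · exact absurd (abs_lt.2 h) (not_lt.2 hp)
  · obtain ⟨g, hg⟩ := h2 p (abs_lt.1 ((sq_lt_one_iff_abs_lt_one _).1 (by linarith)))
    have hχ1 : χ (level α (vec2 p)) = Real.pi := by
      simp only [χ]
      rw [Real.smoothTransition.one_of_one_le, mul_one]
      rw [le_div_iff₀ hδ]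
      linarith
    -- At time `π` the second height changes sign; the extra rotation by `g` preserves heights and
    -- is invisible to `moment`.
    rw [hχ1] at hg
    have e1 := congrArg (fun w => w.1 2) hg
    have e2 := congrArg (fun w => w.2 2) hg
    simp [antiRot, midFlow, midHeight, vec2] at e1 e2
    have : 1 + α ≠ 0 := by positivity
    rw [moment, moment, e1, e2]
    ext
    · simp
      field_simp
      ring
    · simp

/-! ### The flip of the levels above `1` -/

/-- A chart of `S² × S²` centred at the north pole of the first and the south pole of the second
factor. The symplectic form is a constant form in this chart. -/
def capPoint (a b c d : ℝ) : (Fin 3 → ℝ) × (Fin 3 → ℝ) :=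
  (![a * √(2 - (a ^ 2 + b ^ 2)), b * √(2 - (a ^ 2 + b ^ 2)), 1 - (a ^ 2 + b ^ 2)],
    ![c * √(2 - (c ^ 2 + d ^ 2)), d * √(2 - (c ^ 2 + d ^ 2)), c ^ 2 + d ^ 2 - 1])

/-- The coordinates of a point of the first factor, with respect to `capPoint`. -/
def northChart (i : Fin 3) (w : (Fin 3 → ℝ) × (Fin 3 → ℝ)) : ℝ := w.1 i / √(1 + w.1 2)

/-- The coordinates of a point of the second factor, with respect to `capPoint`. -/
def southChart (i : Fin 3) (w : (Fin 3 → ℝ) × (Fin 3 → ℝ)) : ℝ := w.2 i / √(1 - w.2 2)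

/-- The linear flow that exchanges the two factors of the chart `capPoint`. -/
def capFlow (k s : ℝ) (w : (Fin 3 → ℝ) × (Fin 3 → ℝ)) : (Fin 3 → ℝ) × (Fin 3 → ℝ) :=
  capPoint (Real.cos s * northChart 0 w - k * Real.sin s * southChart 0 w)
    (Real.cos s * northChart 1 w + k * Real.sin s * southChart 1 w)
    (Real.sin s / k * northChart 0 w + Real.cos s * southChart 0 w)
    (-(Real.sin s / k) * northChart 1 w + Real.cos s * southChart 1 w)

/-- The real part of the product of the complex coordinates. -/
def capRe (w : (Fin 3 → ℝ) × (Fin 3 → ℝ)) : ℝ :=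
  northChart 0 w * southChart 0 w - northChart 1 w * southChart 1 w

/-- The imaginary part of the product of the complex coordinates. -/
def capIm (w : (Fin 3 → ℝ) × (Fin 3 → ℝ)) : ℝ :=
  (w.1 0 * w.2 1 + w.1 1 * w.2 0) / (√(1 + w.1 2) * √(1 - w.2 2))

/-- The vector field of `capFlow`. -/
def capField (k : ℝ) (w : (Fin 3 → ℝ) × (Fin 3 → ℝ)) : (Fin 3 → ℝ) × (Fin 3 → ℝ) :=
  (k • ![-southChart 0 w * √(1 + w.1 2) + northChart 0 w * capRe w / √(1 + w.1 2),
      southChart 1 w * √(1 + w.1 2) + northChart 1 w * capRe w / √(1 + w.1 2), 2 * capRe w],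
    k⁻¹ • ![northChart 0 w * √(1 - w.2 2) - southChart 0 w * capRe w / √(1 - w.2 2),
      -northChart 1 w * √(1 - w.2 2) - southChart 1 w * capRe w / √(1 - w.2 2), 2 * capRe w])

/-- The Hamiltonian of `capFlow`. -/
def capHam (α k : ℝ) (w : (Fin 3 → ℝ) × (Fin 3 → ℝ)) : ℝ := -(α / (k * Real.pi)) * capIm w

lemma capPoint_mem_range {a b c d : ℝ} (h₁ : a ^ 2 + b ^ 2 < 2) (h₂ : c ^ 2 + d ^ 2 < 2) :
    capPoint a b c d ∈ Set.range vec2 := by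
  have e₁ := Real.sq_sqrt (show 0 ≤ 2 - (a ^ 2 + b ^ 2) by linarith)
  have e₂ := Real.sq_sqrt (show 0 ≤ 2 - (c ^ 2 + d ^ 2) by linarith)
  rw [mem_range_vec2]
  simp only [capPoint, Matrix.cons_val]
  exact ⟨by linear_combination (a ^ 2 + b ^ 2) * e₁, by linear_combination (c ^ 2 + d ^ 2) * e₂⟩

lemma level_capPoint (α a b c d : ℝ) : level α (capPoint a b c d) =
    1 + 2 * α - ((1 + α) * (a ^ 2 + b ^ 2) + α * (c ^ 2 + d ^ 2)) := by
  simp [level, capPoint]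
  ring

lemma sqrt_north_capPoint (a b c d : ℝ) :
    √(1 + (capPoint a b c d).1 2) = √(2 - (a ^ 2 + b ^ 2)) := by
  simp only [capPoint, Matrix.cons_val]
  congr 1
  ring

lemma sqrt_south_capPoint (a b c d : ℝ) :
    √(1 - (capPoint a b c d).2 2) = √(2 - (c ^ 2 + d ^ 2)) := by
  simp only [capPoint, Matrix.cons_val]
  congr 1
  ring

lemma northChart_capPoint {a b : ℝ} (c d : ℝ) (h : a ^ 2 + b ^ 2 < 2) :
    northChart 0 (capPoint a b c d) = a ∧ northChart 1 (capPoint a b c d) = b := by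
  have := Real.sqrt_pos.2 (show 0 < 2 - (a ^ 2 + b ^ 2) by linarith)
  rw [northChart, northChart, sqrt_north_capPoint]
  simp only [capPoint, Matrix.cons_val]
  constructor <;> field_simp

lemma southChart_capPoint (a b : ℝ) {c d : ℝ} (h : c ^ 2 + d ^ 2 < 2) :
    southChart 0 (capPoint a b c d) = c ∧ southChart 1 (capPoint a b c d) = d := by
  have := Real.sqrt_pos.2 (show 0 < 2 - (c ^ 2 + d ^ 2) by linarith)
  rw [southChart, southChart, sqrt_south_capPoint]
  simp only [capPoint, Matrix.cons_val]
  constructor <;> field_simp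

/-- Every point of level greater than `1` is in the range of the chart. -/
lemma exists_capPoint {α : ℝ} (hα : 0 < α) {w : (Fin 3 → ℝ) × (Fin 3 → ℝ)}
    (hw : w ∈ levelSet α (Set.Ioi 1)) : ∃ a b c d,
      w = capPoint a b c d ∧ (1 + α) * (a ^ 2 + b ^ 2) + α * (c ^ 2 + d ^ 2) < 2 * α := by
  obtain ⟨hr, hl⟩ := hw
  obtain ⟨e₁, e₂⟩ := mem_range_vec2.1 hr
  have hl' : 1 < (1 + α) * w.1 2 - α * w.2 2 := hl
  have h1 : 0 < 1 + w.1 2 := by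
    nlinarith [sq_nonneg (w.2 0), sq_nonneg (w.2 1), sq_nonneg (w.2 2 + 1), sq_nonneg (w.2 2 - 1)]
  have h2 : 0 < 1 - w.2 2 := by
    nlinarith [sq_nonneg (w.1 0), sq_nonneg (w.1 1), sq_nonneg (w.1 2 + 1), sq_nonneg (w.1 2 - 1)]
  have s1 := Real.sqrt_pos.2 h1
  have s2 := Real.sqrt_pos.2 h2
  have q1 := Real.sq_sqrt h1.le
  have q2 := Real.sq_sqrt h2.le
  have n1 : northChart 0 w ^ 2 + northChart 1 w ^ 2 = 1 - w.1 2 := by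
    rw [northChart, northChart]
    field_simp
    rw [q1]
    linear_combination e₁
  have n2 : southChart 0 w ^ 2 + southChart 1 w ^ 2 = 1 + w.2 2 := by
    rw [southChart, southChart]
    field_simp
    rw [q2]
    linear_combination e₂
  have t1 : 2 - (1 - w.1 2) = 1 + w.1 2 := by ring
  have t2 : 2 - (1 + w.2 2) = 1 - w.2 2 := by ring
  refine ⟨northChart 0 w, northChart 1 w, southChart 0 w, southChart 1 w, ?_, ?_⟩
  · rw [capPoint, n1, n2, t1, t2]
    refine Prod.ext ?_ ?_ <;> funext i <;> fin_cases i <;> simp [northChart, southChart] <;>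
      field_simp
  · rw [n1, n2]
    linarith

/-- In the chart, levels above `1` form an ellipsoid that stays away from the opposite poles, where
the square roots vanish. -/
lemma lt_two_of_cap {α n m : ℝ} (hα : 0 < α) (hn : 0 ≤ n) (hm : 0 ≤ m)
    (h : (1 + α) * n + α * m < 2 * α) : n < 2 ∧ m < 2 := by
  constructor <;> nlinarith

/-- The linear flow preserves the level. -/
lemma cap_level_eq {α k : ℝ} (hk : 0 < k) (hkα : k ^ 2 * (1 + α) = α) (s a b c d : ℝ) :
    (1 + α) * ((Real.cos s * a - k * Real.sin s * c) ^ 2 +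
      (Real.cos s * b + k * Real.sin s * d) ^ 2) +
      α * ((Real.sin s / k * a + Real.cos s * c) ^ 2 +
        (-(Real.sin s / k) * b + Real.cos s * d) ^ 2) =
    (1 + α) * (a ^ 2 + b ^ 2) + α * (c ^ 2 + d ^ 2) := by
  -- With `z₁ = a + ib` and `z₂ = c + id`, the choice of `k` makes the flow an orthogonal rotation
  -- of the pair `√(1 + α) z₁`, `√α` times the conjugate of `z₂`. The level is affine in the squared
  -- norm of this pair.
  have hs := Real.sin_sq_add_cos_sq s
  field_simp
  linear_combination (k ^ 2 * (1 + α) * (a ^ 2 + b ^ 2) + α * k ^ 2 * (c ^ 2 + d ^ 2)) * hs +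
    (k ^ 2 * Real.sin s ^ 2 * (c ^ 2 + d ^ 2) - Real.sin s ^ 2 * (a ^ 2 + b ^ 2) -
      2 * k * Real.sin s * Real.cos s * (a * c - b * d)) * hkα

lemma capFlow_capPoint (k s : ℝ) {a b c d : ℝ} (h₁ : a ^ 2 + b ^ 2 < 2)
    (h₂ : c ^ 2 + d ^ 2 < 2) : capFlow k s (capPoint a b c d) =
      capPoint (Real.cos s * a - k * Real.sin s * c) (Real.cos s * b + k * Real.sin s * d)
        (Real.sin s / k * a + Real.cos s * c) (-(Real.sin s / k) * b + Real.cos s * d) := by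
  rw [capFlow, (northChart_capPoint c d h₁).1, (northChart_capPoint c d h₁).2,
    (southChart_capPoint a b h₂).1, (southChart_capPoint a b h₂).2]

lemma capIm_capPoint {a b c d : ℝ} (h₁ : a ^ 2 + b ^ 2 < 2) (h₂ : c ^ 2 + d ^ 2 < 2) :
    capIm (capPoint a b c d) = a * d + b * c := by
  have e₁ := Real.sqrt_pos.2 (show 0 < 2 - (a ^ 2 + b ^ 2) by linarith)
  have e₂ := Real.sqrt_pos.2 (show 0 < 2 - (c ^ 2 + d ^ 2) by linarith)
  rw [capIm, sqrt_north_capPoint, sqrt_south_capPoint]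
  simp only [capPoint, Matrix.cons_val]
  field_simp

lemma capRe_capPoint {a b c d : ℝ} (h₁ : a ^ 2 + b ^ 2 < 2) (h₂ : c ^ 2 + d ^ 2 < 2) :
    capRe (capPoint a b c d) = a * c - b * d := by
  rw [capRe, (northChart_capPoint c d h₁).1, (northChart_capPoint c d h₁).2,
    (southChart_capPoint a b h₂).1, (southChart_capPoint a b h₂).2]

lemma capField_capPoint (k : ℝ) {a b c d : ℝ} (h₁ : a ^ 2 + b ^ 2 < 2)
    (h₂ : c ^ 2 + d ^ 2 < 2) : capField k (capPoint a b c d) =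
      (k • ![-c * √(2 - (a ^ 2 + b ^ 2)) + a * (a * c - b * d) / √(2 - (a ^ 2 + b ^ 2)),
        d * √(2 - (a ^ 2 + b ^ 2)) + b * (a * c - b * d) / √(2 - (a ^ 2 + b ^ 2)),
        2 * (a * c - b * d)],
      k⁻¹ • ![a * √(2 - (c ^ 2 + d ^ 2)) - c * (a * c - b * d) / √(2 - (c ^ 2 + d ^ 2)),
        -b * √(2 - (c ^ 2 + d ^ 2)) - d * (a * c - b * d) / √(2 - (c ^ 2 + d ^ 2)),
        2 * (a * c - b * d)]) := by
  rw [capField, capRe_capPoint h₁ h₂, (northChart_capPoint c d h₁).1,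
    (northChart_capPoint c d h₁).2, (southChart_capPoint a b h₂).1,
    (southChart_capPoint a b h₂).2, sqrt_north_capPoint, sqrt_south_capPoint]

lemma hasDerivAt_capPoint {a b c d : ℝ → ℝ} {a' b' c' d' t : ℝ} (ha : HasDerivAt a a' t)
    (hb : HasDerivAt b b' t) (hc : HasDerivAt c c' t) (hd : HasDerivAt d d' t)
    (h₁ : a t ^ 2 + b t ^ 2 < 2) (h₂ : c t ^ 2 + d t ^ 2 < 2) :
    HasDerivAt (fun s => capPoint (a s) (b s) (c s) (d s))
      (![a' * √(2 - (a t ^ 2 + b t ^ 2)) -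
          a t * (a t * a' + b t * b') / √(2 - (a t ^ 2 + b t ^ 2)),
        b' * √(2 - (a t ^ 2 + b t ^ 2)) -
          b t * (a t * a' + b t * b') / √(2 - (a t ^ 2 + b t ^ 2)),
        -2 * (a t * a' + b t * b')],
      ![c' * √(2 - (c t ^ 2 + d t ^ 2)) -
          c t * (c t * c' + d t * d') / √(2 - (c t ^ 2 + d t ^ 2)),
        d' * √(2 - (c t ^ 2 + d t ^ 2)) -
          d t * (c t * c' + d t * d') / √(2 - (c t ^ 2 + d t ^ 2)),
        2 * (c t * c' + d t * d')]) t := by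
  have hn := (ha.fun_pow 2).add (hb.fun_pow 2)
  have hm := (hc.fun_pow 2).add (hd.fun_pow 2)
  have hS := (hn.const_sub 2).sqrt (show 2 - (a t ^ 2 + b t ^ 2) ≠ 0 by linarith)
  have hT := (hm.const_sub 2).sqrt (show 2 - (c t ^ 2 + d t ^ 2) ≠ 0 by linarith)
  have e₁ := Real.sqrt_pos.2 (show 0 < 2 - (a t ^ 2 + b t ^ 2) by linarith)
  have e₂ := Real.sqrt_pos.2 (show 0 < 2 - (c t ^ 2 + d t ^ 2) by linarith)
  convert! (hasDerivAt_vec3 (ha.mul hS) (hb.mul hS) (hn.const_sub 1)).prodMk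
    (hasDerivAt_vec3 (hc.mul hT) (hd.mul hT) (hm.sub_const 1)) using 1
  simp only [Pi.add_apply]
  generalize √(2 - (a t ^ 2 + b t ^ 2)) = σ at *
  generalize √(2 - (c t ^ 2 + d t ^ 2)) = τ at *
  refine Prod.ext ?_ ?_ <;> funext i <;> fin_cases i <;>
    simp [-mul_eq_mul_left_iff, -mul_eq_mul_right_iff] <;> field_simp <;> ring

lemma contDiffAt_capPoint {E : Type*} [NormedAddCommGroup E] [NormedSpace ℝ E]
    {a b c d : E → ℝ} {x : E} (ha : ContDiffAt ℝ ∞ a x) (hb : ContDiffAt ℝ ∞ b x)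
    (hc : ContDiffAt ℝ ∞ c x) (hd : ContDiffAt ℝ ∞ d x)
    (h₁ : a x ^ 2 + b x ^ 2 < 2) (h₂ : c x ^ 2 + d x ^ 2 < 2) :
    ContDiffAt ℝ ∞ (fun y => capPoint (a y) (b y) (c y) (d y)) x := by
  have hS : ContDiffAt ℝ ∞ (fun y => √(2 - (a y ^ 2 + b y ^ 2))) x :=
    ContDiffAt.sqrt (by fun_prop) (by linarith)
  have hT : ContDiffAt ℝ ∞ (fun y => √(2 - (c y ^ 2 + d y ^ 2))) x :=
    ContDiffAt.sqrt (by fun_prop) (by linarith)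
  exact ContDiffAt.prodMk (contDiffAt_vec3 (ha.mul hS) (hb.mul hS) (by fun_prop))
    (contDiffAt_vec3 (hc.mul hT) (hd.mul hT) (by fun_prop))

/-- The contribution of one factor to Hamilton's equation, stated for the northern chart so that it
serves both factors. -/
lemma cap_det_eq {a b c d σ : ℝ} (hσ : 0 < σ) (hσ2 : σ ^ 2 = 2 - (a ^ 2 + b ^ 2))
    {v : Fin 3 → ℝ} (hv : dot3 ![a * σ, b * σ, 1 - (a ^ 2 + b ^ 2)] v = 0) :
    det3 ![a * σ, b * σ, 1 - (a ^ 2 + b ^ 2)]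
      ![-c * σ + a * (a * c - b * d) / σ, d * σ + b * (a * c - b * d) / σ, 2 * (a * c - b * d)] v =
    -2 * (d * v 0 + c * v 1) / σ + (a * d + b * c) * v 2 / σ ^ 2 := by
  simp only [det3, dot3, Matrix.cons_val] at *
  have key : σ ^ 2 * (a * σ * ((d * σ + b * (a * c - b * d) / σ) * v 2 -
      2 * (a * c - b * d) * v 1) - b * σ * ((-c * σ + a * (a * c - b * d) / σ) * v 2 -
      2 * (a * c - b * d) * v 0) + (1 - (a ^ 2 + b ^ 2)) *
      ((-c * σ + a * (a * c - b * d) / σ) * v 1 - (d * σ + b * (a * c - b * d) / σ) * v 0)) =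
      -2 * (d * v 0 + c * v 1) * σ + (a * d + b * c) * v 2 := by
    field_simp
    linear_combination (a * d + b * c) * (3 - (a ^ 2 + b ^ 2)) * hv +
      (σ * (2 * b * (a * c - b * d) - (1 - (a ^ 2 + b ^ 2)) * d) * v 0 +
        σ * (-(1 - (a ^ 2 + b ^ 2)) * c - 2 * a * (a * c - b * d)) * v 1 +
        (a * d + b * c) * (σ ^ 2 + 2 - (a ^ 2 + b ^ 2)) * v 2) * hσ2
  have h : -2 * (d * v 0 + c * v 1) / σ + (a * d + b * c) * v 2 / σ ^ 2 =
      (-2 * (d * v 0 + c * v 1) * σ + (a * d + b * c) * v 2) / σ ^ 2 := by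
    field_simp
  rw [h, ← key]
  field_simp

lemma contDiffAt_north {w : (Fin 3 → ℝ) × (Fin 3 → ℝ)} (i : Fin 3) (hw : √(1 + w.1 2) ≠ 0) :
    ContDiffAt ℝ ∞ (northChart i) w := by
  have h : 1 + w.1 2 ≠ 0 := fun h => hw (by rw [h, Real.sqrt_zero])
  exact ContDiffAt.div (by fun_prop) (ContDiffAt.sqrt (by fun_prop) h) hw

lemma contDiffAt_south {w : (Fin 3 → ℝ) × (Fin 3 → ℝ)} (i : Fin 3) (hw : √(1 - w.2 2) ≠ 0) :
    ContDiffAt ℝ ∞ (southChart i) w := by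
  have h : 1 - w.2 2 ≠ 0 := fun h => hw (by rw [h, Real.sqrt_zero])
  exact ContDiffAt.div (by fun_prop) (ContDiffAt.sqrt (by fun_prop) h) hw

lemma contDiffAt_capIm {w : (Fin 3 → ℝ) × (Fin 3 → ℝ)} (h₁ : √(1 + w.1 2) ≠ 0)
    (h₂ : √(1 - w.2 2) ≠ 0) : ContDiffAt ℝ ∞ capIm w := by
  have h : 1 + w.1 2 ≠ 0 := fun h => h₁ (by rw [h, Real.sqrt_zero])
  have h' : 1 - w.2 2 ≠ 0 := fun h => h₂ (by rw [h, Real.sqrt_zero])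
  have hS : ContDiffAt ℝ ∞ (fun w : (Fin 3 → ℝ) × (Fin 3 → ℝ) => √(1 + w.1 2)) w :=
    ContDiffAt.sqrt (by fun_prop) h
  have hT : ContDiffAt ℝ ∞ (fun w : (Fin 3 → ℝ) × (Fin 3 → ℝ) => √(1 - w.2 2)) w :=
    ContDiffAt.sqrt (by fun_prop) h'
  exact ContDiffAt.div (by fun_prop) (hS.mul hT) (mul_ne_zero h₁ h₂)

lemma cap_sqrt_pos {a b : ℝ} (h : a ^ 2 + b ^ 2 < 2) : 0 < √(2 - (a ^ 2 + b ^ 2)) :=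
  Real.sqrt_pos.2 (by linarith)

lemma ambientForm_capField {α k : ℝ} (hk : 0 < k) (hkα : k ^ 2 * (1 + α) = α) {a b c d : ℝ}
    (h₁ : a ^ 2 + b ^ 2 < 2) (h₂ : c ^ 2 + d ^ 2 < 2) (v : (Fin 3 → ℝ) × (Fin 3 → ℝ))
    (hv₁ : dot3 (capPoint a b c d).1 v.1 = 0) (hv₂ : dot3 (capPoint a b c d).2 v.2 = 0) :
    ambientForm α (capPoint a b c d).1 (capField k (capPoint a b c d)).1 v.1
      (capPoint a b c d).2 (capField k (capPoint a b c d)).2 v.2 =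
      fderiv ℝ (capHam α k) (capPoint a b c d) v := by
  have p1 := cap_sqrt_pos h₁
  have p2 := cap_sqrt_pos h₂
  have q1 := Real.sq_sqrt (show 0 ≤ 2 - (a ^ 2 + b ^ 2) by linarith)
  have q2 := Real.sq_sqrt (show 0 ≤ 2 - (c ^ 2 + d ^ 2) by linarith)
  have r1 : 1 + (1 - (a ^ 2 + b ^ 2)) = 2 - (a ^ 2 + b ^ 2) := by ring
  have r2 : 1 - (c ^ 2 + d ^ 2 - 1) = 2 - (c ^ 2 + d ^ 2) := by ring
  have hl (x y : ℝ) : HasDerivAt (fun s : ℝ => x + s * y) y 0 := by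
    simpa using ((hasDerivAt_id (0 : ℝ)).mul_const y).const_add x
  have hS : HasDerivAt (fun s : ℝ => √(1 + (1 - (a ^ 2 + b ^ 2) + s * v.1 2)))
      (v.1 2 / (2 * √(2 - (a ^ 2 + b ^ 2)))) 0 := by
    have := ((hl (1 - (a ^ 2 + b ^ 2)) (v.1 2)).const_add 1).sqrt
      (show 1 + (1 - (a ^ 2 + b ^ 2) + 0 * v.1 2) ≠ 0 by linarith)
    simpa [r1] using this
  have hT : HasDerivAt (fun s : ℝ => √(1 - (c ^ 2 + d ^ 2 - 1 + s * v.2 2)))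
      (-v.2 2 / (2 * √(2 - (c ^ 2 + d ^ 2)))) 0 := by
    have := ((hl (c ^ 2 + d ^ 2 - 1) (v.2 2)).const_sub 1).sqrt
      (show 1 - (c ^ 2 + d ^ 2 - 1 + 0 * v.2 2) ≠ 0 by linarith)
    simpa [r2] using this
  have hF : HasDerivAt (fun s : ℝ => capHam α k (capPoint a b c d + s • v))
      (-(α / (k * Real.pi)) *
        ((d * v.1 0 + c * v.1 1) / √(2 - (a ^ 2 + b ^ 2)) -
          (a * d + b * c) * v.1 2 / (2 * √(2 - (a ^ 2 + b ^ 2)) ^ 2) +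
          (a * v.2 1 + b * v.2 0) / √(2 - (c ^ 2 + d ^ 2)) +
          (a * d + b * c) * v.2 2 / (2 * √(2 - (c ^ 2 + d ^ 2)) ^ 2))) 0 := by
    have := ((((hl ((capPoint a b c d).1 0) (v.1 0)).mul (hl ((capPoint a b c d).2 1) (v.2 1))).add
      ((hl ((capPoint a b c d).1 1) (v.1 1)).mul (hl ((capPoint a b c d).2 0) (v.2 0)))).div
        (hS.mul hT) (by simp [r1, r2, p1.ne', p2.ne'])).const_mul (-(α / (k * Real.pi)))
    convert! this using 1
    simp [r1, r2, -mul_eq_mul_left_iff, -neg_inj]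
    simp only [capPoint, Matrix.cons_val]
    generalize √(2 - (a ^ 2 + b ^ 2)) = σ at *
    generalize √(2 - (c ^ 2 + d ^ 2)) = τ at *
    congr 2
    field_simp
    ring
  rw [fderiv_apply_of_hasDerivAt_line ?_ hF]
  · rw [capField_capPoint k h₁ h₂]
    have E1 := cap_det_eq (c := c) (d := d) p1 q1 (v := v.1) hv₁
    -- Reflecting the height turns the southern chart into the northern one. The field then becomes
    -- minus the field in `cap_det_eq`, which cancels the sign the reflection gives to the
    -- determinant.
    have E2 := cap_det_eq (c := a) (d := b) p2 q2 (v := ![v.2 0, v.2 1, -v.2 2]) (by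
      simp only [dot3, capPoint, Matrix.cons_val] at hv₂ ⊢
      linear_combination hv₂)
    simp only [ambientForm, capPoint, det3, Matrix.cons_val, Pi.smul_apply, smul_eq_mul] at *
    generalize √(2 - (a ^ 2 + b ^ 2)) = σ at *
    generalize √(2 - (c ^ 2 + d ^ 2)) = τ at *
    have hpi := Real.pi_ne_zero
    have hc1 : (α + 1) / (2 * Real.pi) * k = α / (k * Real.pi) / 2 := by
      field_simp
      linear_combination hkα
    have hc2 : α / (2 * Real.pi) * k⁻¹ = α / (k * Real.pi) / 2 := by
      field_simp
    have t1 : (a * d + b * c) * v.1 2 / (2 * σ ^ 2) = (a * d + b * c) * v.1 2 / σ ^ 2 / 2 := by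
      field_simp
    have t2 : (a * d + b * c) * v.2 2 / (2 * τ ^ 2) = (a * d + b * c) * v.2 2 / τ ^ 2 / 2 := by
      field_simp
    rw [t1, t2]
    linear_combination (α + 1) / (2 * Real.pi) * k * E1 + α / (2 * Real.pi) * k⁻¹ * E2 +
      (-2 * (d * v.1 0 + c * v.1 1) / σ + (a * d + b * c) * v.1 2 / σ ^ 2) * hc1 +
      (-2 * (b * v.2 0 + a * v.2 1) / τ + (c * b + d * a) * -v.2 2 / τ ^ 2) * hc2
  · refine (contDiffAt_const.mul (contDiffAt_capIm ?_ ?_)).differentiableAt (by simp)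
    · rw [sqrt_north_capPoint]
      exact p1.ne'
    · rw [sqrt_south_capPoint]
      exact p2.ne'

lemma exists_sq_mul_eq {α : ℝ} (hα : 0 < α) : ∃ k : ℝ, 0 < k ∧ k ^ 2 * (1 + α) = α := by
  refine ⟨√(α / (1 + α)), Real.sqrt_pos.2 (by positivity), ?_⟩
  rw [Real.sq_sqrt (by positivity)]
  field_simp

/-- The flip of the levels above `1`. -/
theorem exists_cap_flip {α δ : ℝ} (hα : 0 < α) (hδ : 0 < δ) : ∃ ψ ∈ Ham α,
    (∀ p, level α (vec2 p) ≤ 1 → ψ p = p) ∧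
    ∀ p, 1 + 2 * δ ≤ level α (vec2 p) → moment α (ψ p) =
      (1 - (moment α p).2, 1 - (moment α p).1) := by
  obtain ⟨k, hk, hkα⟩ := exists_sq_mul_eq hα
  -- The angle `π / 2` in the chart exchanges the factors and is a half-turn of the reduced sphere.
  -- It is reached for `c ≥ 1 + 2δ`, and there is no motion for `c ≤ 1 + δ`.
  let χ : ℝ → ℝ := fun c => Real.pi / 2 * Real.smoothTransition ((c - 1 - δ) / δ)
  have hχ : ContDiff ℝ ∞ χ :=
    contDiff_const.mul (Real.smoothTransition.contDiff.comp (by fun_prop))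
  have cap (w) (hw : w ∈ levelSet α (Set.Ioi 1)) : ∃ a b c d, w = capPoint a b c d ∧
      (a ^ 2 + b ^ 2 < 2 ∧ c ^ 2 + d ^ 2 < 2) ∧ ∀ s,
      (Real.cos s * a - k * Real.sin s * c) ^ 2 + (Real.cos s * b + k * Real.sin s * d) ^ 2 < 2 ∧
      (Real.sin s / k * a + Real.cos s * c) ^ 2 +
        (-(Real.sin s / k) * b + Real.cos s * d) ^ 2 < 2 := by
    obtain ⟨a, b, c, d, rfl, h⟩ := exists_capPoint hα hw
    exact ⟨a, b, c, d, rfl, lt_two_of_cap hα (by positivity) (by positivity) h, fun s =>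
      lt_two_of_cap hα (by positivity) (by positivity)
        ((cap_level_eq hk hkα s a b c d).trans_lt h)⟩
  have ne (w) (hw : w ∈ levelSet α (Set.Ioi 1)) : √(1 + w.1 2) ≠ 0 ∧ √(1 - w.2 2) ≠ 0 := by
    obtain ⟨a, b, c, d, rfl, ⟨h1, h2⟩, -⟩ := cap w hw
    rw [sqrt_north_capPoint, sqrt_south_capPoint]
    exact ⟨(cap_sqrt_pos h1).ne', (cap_sqrt_pos h2).ne'⟩
  obtain ⟨ψ, hψ, h1, h2⟩ := exists_cutoff_flow (α := α) (U := Set.Ioi 1)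
    (C := Set.Ici (1 + δ)) (h := capHam α k) (K := capFlow k) (X := capField k) isOpen_Ioi
    isClosed_Ici (fun c (hc : 1 + δ ≤ c) => show 1 < c by linarith)
    (fun w hw => contDiffAt_const.mul (contDiffAt_capIm (ne w hw).1 (ne w hw).2))
    (fun s w hw => by
      obtain ⟨n1, n2⟩ := ne w hw
      have A (i : Fin 3) : ContDiffAt ℝ ∞
          (fun q : ℝ × ((Fin 3 → ℝ) × (Fin 3 → ℝ)) => northChart i q.2) (s, w) :=
        ContDiffAt.comp (g := northChart i) (f := Prod.snd) (s, w) (contDiffAt_north i n1)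
          contDiffAt_snd
      have B (i : Fin 3) : ContDiffAt ℝ ∞
          (fun q : ℝ × ((Fin 3 → ℝ) × (Fin 3 → ℝ)) => southChart i q.2) (s, w) :=
        ContDiffAt.comp (g := southChart i) (f := Prod.snd) (s, w) (contDiffAt_south i n2)
          contDiffAt_snd
      have A0 := A 0
      have A1 := A 1
      have B0 := B 0
      have B1 := B 1
      obtain ⟨a, b, c, d, rfl, ⟨h1, h2⟩, h3⟩ := cap w hw
      refine contDiffAt_capPoint ?_ ?_ ?_ ?_ ?_ ?_
      · fun_prop
      · fun_prop
      · exact ((Real.contDiff_sin.contDiffAt.comp _ contDiffAt_fst).div_const k).mul A0 |>.add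
          (by fun_prop)
      · exact (((Real.contDiff_sin.contDiffAt.comp _ contDiffAt_fst).div_const k).neg).mul A1 |>.add
          (by fun_prop)
      · simp only [(northChart_capPoint c d h1).1, (northChart_capPoint c d h1).2,
          (southChart_capPoint a b h2).1, (southChart_capPoint a b h2).2]
        exact (h3 s).1
      · simp only [(northChart_capPoint c d h1).1, (northChart_capPoint c d h1).2,
          (southChart_capPoint a b h2).1, (southChart_capPoint a b h2).2]
        exact (h3 s).2)
    (fun w hw => by
      obtain ⟨a, b, c, d, rfl, ⟨h1, h2⟩, -⟩ := cap w hw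
      simp [capFlow_capPoint k 0 h1 h2])
    (fun s w hw => by
      obtain ⟨a, b, c, d, rfl, ⟨h1, h2⟩, h3⟩ := cap w hw
      rw [capFlow_capPoint k s h1 h2]
      exact capPoint_mem_range (h3 s).1 (h3 s).2)
    (fun s w hw => by
      obtain ⟨a, b, c, d, rfl, ⟨h1, h2⟩, -⟩ := cap w hw
      rw [capFlow_capPoint k s h1 h2, level_capPoint, cap_level_eq hk hkα, level_capPoint])
    (fun s w hw => by
      obtain ⟨a, b, c, d, rfl, ⟨h1, h2⟩, h3⟩ := cap w hw
      have hs := Real.sin_sq_add_cos_sq s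
      rw [capFlow_capPoint k s h1 h2, capHam, capHam, capIm_capPoint (h3 s).1 (h3 s).2,
        capIm_capPoint h1 h2]
      congr 1
      field_simp
      linear_combination (a * d + b * c) * k * hs)
    (fun s w hw => by
      obtain ⟨a, b, c, d, rfl, ⟨h1, h2⟩, h3⟩ := cap w hw
      have hs := Real.hasDerivAt_sin s
      have hc := Real.hasDerivAt_cos s
      have H := hasDerivAt_capPoint ((hc.mul_const a).sub ((hs.const_mul k).mul_const c))
        ((hc.mul_const b).add ((hs.const_mul k).mul_const d))
        (((hs.div_const k).mul_const a).add (hc.mul_const c))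
        (((hs.div_const k).neg.mul_const b).add (hc.mul_const d)) (h3 s).1 (h3 s).2
      have p1 := cap_sqrt_pos (h3 s).1
      have p2 := cap_sqrt_pos (h3 s).2
      simp only [capFlow_capPoint k _ h1 h2]
      convert! H using 1
      rw [capField_capPoint k (h3 s).1 (h3 s).2]
      simp only [Pi.add_apply, Pi.sub_apply, Pi.neg_apply]
      generalize √(2 - ((Real.cos s * a - k * Real.sin s * c) ^ 2 +
        (Real.cos s * b + k * Real.sin s * d) ^ 2)) = σ at *
      generalize √(2 - ((Real.sin s / k * a + Real.cos s * c) ^ 2 +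
        (-(Real.sin s / k) * b + Real.cos s * d) ^ 2)) = τ at *
      refine Prod.ext ?_ ?_ <;> funext i <;> fin_cases i <;>
        simp [-mul_eq_mul_left_iff, -mul_eq_mul_right_iff] <;> field_simp <;> ring)
    (fun g w hw => by
      have hs := Real.sin_sq_add_cos_sq g
      have h1 : √(1 + (antiRot g w).1 2) = √(1 + w.1 2) := rfl
      have h2 : √(1 - (antiRot g w).2 2) = √(1 - w.2 2) := rfl
      rw [capHam, capHam, capIm, capIm, h1, h2]
      congr 2
      simp only [antiRot, Matrix.cons_val]
      linear_combination (w.1 0 * w.2 1 + w.1 1 * w.2 0) * hs)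
    (fun g w hw => by
      have hs := Real.sin_sq_add_cos_sq g
      have h1 : √(1 + (antiRot g w).1 2) = √(1 + w.1 2) := rfl
      have h2 : √(1 - (antiRot g w).2 2) = √(1 - w.2 2) := rfl
      have h3 : capRe (antiRot g w) = capRe w := by
        simp only [capRe, northChart, southChart, h1, h2]
        simp only [antiRot, Matrix.cons_val]
        linear_combination (w.1 0 / √(1 + w.1 2) * (w.2 0 / √(1 - w.2 2)) -
          w.1 1 / √(1 + w.1 2) * (w.2 1 / √(1 - w.2 2))) * hs
      simp only [capField, h3, northChart, southChart, h1, h2]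
      refine Prod.ext ?_ ?_ <;> funext i <;> fin_cases i <;> simp [antiRot] <;> ring)
    (fun w hw v hv₁ hv₂ => by
      obtain ⟨a, b, c, d, rfl, ⟨h1, h2⟩, -⟩ := cap w hw
      exact ambientForm_capField hk hkα h1 h2 v hv₁ hv₂) hχ
    (fun c hc => by
      have : c < 1 + δ := not_le.1 hc
      simp only [χ]
      rw [Real.smoothTransition.zero_of_nonpos, mul_zero]
      exact div_nonpos_of_nonpos_of_nonneg (by linarith) hδ.le)
  refine ⟨ψ, hψ, fun p hp => h1 p (not_lt.2 hp), fun p hp => ?_⟩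
  have hp1 : 1 < level α (vec2 p) := by linarith
  obtain ⟨g, hg⟩ := h2 p hp1
  have hχ1 : χ (level α (vec2 p)) = Real.pi / 2 := by
    simp only [χ]
    rw [Real.smoothTransition.one_of_one_le, mul_one]
    rw [le_div_iff₀ hδ]
    linarith
  -- The exchange swaps `(1 + α)|z₁|²` and `α|z₂|²`, which are the distances `1 + α - x` and `α + y`
  -- to the two sides at the corner.
  rw [hχ1] at hg
  obtain ⟨a, b, c, d, hw, ⟨h1, h2⟩, -⟩ := cap (vec2 p) ⟨⟨p, rfl⟩, hp1⟩
  rw [hw, capFlow_capPoint k _ h1 h2] at hg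
  have e1 := congrArg (fun w => w.1 2) hg
  have e2 := congrArg (fun w => w.2 2) hg
  have e3 := congrArg (fun w => w.1 2) hw
  have e4 := congrArg (fun w => w.2 2) hw
  simp [antiRot, capPoint, vec2] at e1 e2 e3 e4
  rw [moment, moment, e1, e2, e3, e4]
  ext
  · simp only
    linear_combination -(c ^ 2 + d ^ 2) * hkα
  · simp only
    field_simp
    linear_combination -(a ^ 2 + b ^ 2) * hkα

/-! ### The billiard map -/

/-- The action on the moment polytope of the composition of the flips with the reflection
`(x, y) ↦ (x, -y)`. -/
def tableMap (q : ℝ × ℝ) : ℝ × ℝ :=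
  if 1 < q.1 - q.2 then (1 - q.2, q.1 - 1)
  else if q.1 - q.2 < -1 then (-1 - q.2, 1 + q.1) else (q.1 - 2 * q.2, q.2)

lemma level_eq_moment (α : ℝ) (p : S2xS2) :
    level α (vec2 p) = (moment α p).1 - (moment α p).2 := rfl

lemma exists_ham_tableMap {α δ : ℝ} (hα : 0 < α) (hδ : 0 < δ) : ∃ ψ ∈ Ham α, ∀ p,
    (((moment α p).1 - (moment α p).2) ^ 2 ≤ 1 - 2 * δ ∨
      1 + 2 * δ ≤ |(moment α p).1 - (moment α p).2|) →
    moment α (ψ p) = tableMap (moment α p) := by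
  obtain ⟨A, hA, hA1, hA2⟩ := exists_mid_flip hα hδ
  obtain ⟨B, hB, hB1, hB2⟩ := exists_cap_flip hα hδ
  let τ : S2xS2 → S2xS2 := Prod.map (rotX 0) (rotX Real.pi)
  let σ : S2xS2 → S2xS2 := Prod.map (rotX Real.pi) (rotX Real.pi)
  have hτ : τ ∈ Ham α := prodMap_rotX_mem_Ham α 0 Real.pi
  have hσ : σ ∈ Ham α := prodMap_rotX_mem_Ham α Real.pi Real.pi
  have mτ (p) : moment α (τ p) = ((moment α p).1, -(moment α p).2) := by
    rw [moment_rotX, moment]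
    simp
  have mσ (p) : moment α (σ p) = (-(moment α p).1, -(moment α p).2) := by
    rw [moment_rotX, moment]
    simp
  -- Since `σ` negates the level, `σ ∘ B ∘ σ` is the flip below `-1`. The three flips preserve the
  -- level of the points considered and act on disjoint ranges of levels, so just one of them moves
  -- each point.
  refine ⟨τ ∘ A ∘ B ∘ σ ∘ B ∘ σ, comp_mem_Ham hτ (comp_mem_Ham hA (comp_mem_Ham hB
    (comp_mem_Ham hσ (comp_mem_Ham hB hσ)))),
    fun p hp => ?_⟩
  have mA1 (p) (h : 1 ≤ |(moment α p).1 - (moment α p).2|) : moment α (A p) = moment α p := by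
    rw [hA1 p h]
  have mB1 (p) (h : (moment α p).1 - (moment α p).2 ≤ 1) : moment α (B p) = moment α p := by
    rw [hB1 p h]
  simp only [Function.comp_apply, mτ, tableMap]
  rcases hp with hp | hp
  · have h := abs_lt.1 ((sq_lt_one_iff_abs_lt_one _).1
      (show ((moment α p).1 - (moment α p).2) ^ 2 < 1 by linarith))
    have e1 : moment α (B (σ p)) = (-(moment α p).1, -(moment α p).2) := by
      rw [mB1, mσ]
      rw [mσ]
      linarith
    have e2 : moment α (σ (B (σ p))) = moment α p := by
      rw [mσ, e1]
      simp
    have e3 : moment α (B (σ (B (σ p)))) = moment α p := by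
      rw [mB1, e2]
      rw [e2]
      linarith
    rw [if_neg (by linarith), if_neg (by linarith), hA2, e3]
    · simp
    · rw [level_eq_moment, e3]
      exact hp
  · rcases le_abs.1 hp with h | h
    · have e1 : moment α (B (σ p)) = (-(moment α p).1, -(moment α p).2) := by
        rw [mB1, mσ]
        rw [mσ]
        linarith
      have e2 : moment α (σ (B (σ p))) = moment α p := by
        rw [mσ, e1]
        simp
      have e3 : moment α (B (σ (B (σ p)))) = (1 - (moment α p).2, 1 - (moment α p).1) := by
        rw [hB2, e2]
        rw [level_eq_moment, e2]
        exact h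
      rw [if_pos (by linarith), mA1, e3]
      · simp
      · rw [e3]
        exact le_abs.2 (Or.inl (by simp only; linarith))
    · have e1 : moment α (B (σ p)) = (1 + (moment α p).2, 1 + (moment α p).1) := by
        rw [hB2, mσ]
        · simp
        · rw [level_eq_moment, mσ]
          simp only
          linarith
      have e2 : moment α (σ (B (σ p))) = (-(1 + (moment α p).2), -(1 + (moment α p).1)) := by
        rw [mσ, e1]
      have e3 : moment α (B (σ (B (σ p)))) = (-(1 + (moment α p).2), -(1 + (moment α p).1)) := by
        rw [mB1, e2]
        rw [e2]
        simp only
        linarith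
      rw [if_neg (by linarith), if_pos (by linarith), mA1, e3]
      · ext <;> simp only <;> ring
      · rw [e3]
        exact le_abs.2 (Or.inr (by simp only; linarith))

/-! ### Arc length on the table, and the billiard map as a rotation. -/

/-- The point `q` lies on the boundary of the rectangle `[-1 - r, 1 + r] × [-r, r]`, at the
position `s`. Positions are arc lengths up to the central symmetry, so that they are real numbers
modulo `2 + 4 r`. -/
def AtPosition (r : ℝ) (q : ℝ × ℝ) (s : ℝ) : Prop :=
  ∃ n : ℤ, (q.2 = r ∧ |q.1| ≤ 1 + r ∧ s = 1 + r - q.1 + n * (2 + 4 * r)) ∨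
    (q.2 = -r ∧ |q.1| ≤ 1 + r ∧ s = 1 + r + q.1 + n * (2 + 4 * r)) ∨
    (q.1 = 1 + r ∧ |q.2| ≤ r ∧ s = 2 + 3 * r + q.2 + n * (2 + 4 * r)) ∨
    (q.1 = -1 - r ∧ |q.2| ≤ r ∧ s = 2 + 3 * r - q.2 + n * (2 + 4 * r))

lemma exists_atPosition {x y : ℝ} : ∃ s, AtPosition (tableRadius x y) (x, y) s := by
  unfold tableRadius AtPosition
  rcases le_total (|x| - 1) |y| with h | h
  · rw [max_eq_right h]
    rcases abs_choice y with e | e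
    · exact ⟨_, 0, Or.inl ⟨e.symm, by simp only; linarith, rfl⟩⟩
    · exact ⟨_, 0, Or.inr (Or.inl ⟨by simp only; linarith, by simp only; linarith, rfl⟩)⟩
  · rw [max_eq_left h]
    rcases abs_choice x with e | e
    · exact ⟨_, 0, Or.inr (Or.inr (Or.inl ⟨by simp only; linarith, h, rfl⟩))⟩
    · exact ⟨_, 0, Or.inr (Or.inr (Or.inr ⟨by simp only; linarith, h, rfl⟩))⟩

/-- The billiard map is a rotation of the boundary of the rectangle. -/
lemma AtPosition.tableMap {r s : ℝ} {q : ℝ × ℝ} (h : AtPosition r q s) (hr : 0 < r)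
    (hq : |q.1 - q.2| ≠ 1) : AtPosition r (tableMap q) (s + 2 * r) := by
  obtain ⟨x, y⟩ := q
  have hq1 : x - y ≠ 1 := fun h => hq (by simp [h])
  have hq2 : x - y ≠ -1 := fun h => hq (by simp [h])
  obtain ⟨n, ⟨h1, h2, h3⟩ | ⟨h1, h2, h3⟩ | ⟨h1, h2, h3⟩ | ⟨h1, h2, h3⟩⟩ := h <;>
    simp only at h1 h2 h3 <;> obtain ⟨h4, h5⟩ := abs_le.1 h2 <;> subst h1 <;>
    simp only [SplitTori.tableMap]
  · rw [if_neg (by linarith)]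
    split_ifs with hc
    · exact ⟨n, Or.inr (Or.inr (Or.inr ⟨rfl,
        abs_le.2 ⟨by simp only; linarith, by simp only; linarith⟩, by simp only; linarith⟩))⟩
    · have : -1 < x - y := lt_of_le_of_ne (not_lt.1 hc) (Ne.symm hq2)
      exact ⟨n, Or.inl ⟨rfl, abs_le.2 ⟨by simp only; linarith, by simp only; linarith⟩,
        by simp only; linarith⟩⟩
  · split_ifs with hc hc'
    · exact ⟨n, Or.inr (Or.inr (Or.inl ⟨by simp only; ring,
        abs_le.2 ⟨by simp only; linarith, by simp only; linarith⟩, by simp only; linarith⟩))⟩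
    · linarith
    · exact ⟨n, Or.inr (Or.inl ⟨rfl,
        abs_le.2 ⟨by simp only; linarith, by simp only; linarith⟩, by simp only; linarith⟩)⟩
  · have : 1 < 1 + r - y := lt_of_le_of_ne (by linarith) (Ne.symm hq1)
    rw [if_pos this]
    -- The point turns the corner at position `2 + 4r`, where the parameter starts again from `0`.
    refine ⟨n + 1, Or.inl ⟨by simp only; ring,
      abs_le.2 ⟨by simp only; linarith, by simp only; linarith⟩, ?_⟩⟩
    push_cast
    linarith
  · have : -1 - r - y < -1 := lt_of_le_of_ne (by linarith) hq2
    rw [if_neg (by linarith), if_pos this]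
    refine ⟨n + 1, Or.inr (Or.inl ⟨by simp only; ring,
      abs_le.2 ⟨by simp only; linarith, by simp only; linarith⟩, ?_⟩)⟩
    push_cast
    linarith

lemma AtPosition.unique {r s s' : ℝ} {q : ℝ × ℝ} (h : AtPosition r q s) (h' : AtPosition r q s')
    (hr : 0 < r) : ∃ n : ℤ, s - s' = n * (2 + 4 * r) := by
  obtain ⟨n, h⟩ := h
  obtain ⟨m, h'⟩ := h'
  rcases h with ⟨h1, -, h3⟩ | ⟨h1, -, h3⟩ | ⟨h1, -, h3⟩ | ⟨h1, -, h3⟩ <;>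
    rcases h' with ⟨h4, -, h6⟩ | ⟨h4, -, h6⟩ | ⟨h4, -, h6⟩ | ⟨h4, -, h6⟩ <;>
    first
    | linarith
    | (refine ⟨n - m, ?_⟩; push_cast; linarith)
    | (refine ⟨n - m - 1, ?_⟩; push_cast; linarith)
    | (refine ⟨n - m + 1, ?_⟩; push_cast; linarith)

/-- The lines `x - y = ±1` meet the table in the corners `±(1 + r, r)`, at position `0`, and in the
points `±(r - 1, r)`, at position `2 ≡ -4r`. -/
lemma AtPosition.of_level {r s : ℝ} {q : ℝ × ℝ} (h : AtPosition r q s)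
    (hq : |q.1 - q.2| = 1) : ∃ n : ℤ, s = n * (2 + 4 * r) ∨ s = -(4 * r) + n * (2 + 4 * r) := by
  obtain ⟨n, ⟨h1, h2, h3⟩ | ⟨h1, h2, h3⟩ | ⟨h1, h2, h3⟩ | ⟨h1, h2, h3⟩⟩ := h <;>
    obtain ⟨h4, h5⟩ := abs_le.1 h2 <;> rcases eq_or_eq_neg_of_abs_eq hq with h | h <;>
    first
    | (exfalso; linarith)
    | (refine ⟨n, Or.inl ?_⟩; linarith)
    | (refine ⟨n + 1, Or.inl ?_⟩; push_cast; linarith)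
    | (refine ⟨n + 1, Or.inr ?_⟩; push_cast; linarith)

/-- The reflection reverses the orientation of the boundary, so the forward orbit of the reflected
point mirrors a backward orbit. -/
lemma AtPosition.reflect {r s x y : ℝ} (h : AtPosition r (x, y) s) :
    AtPosition r (x, -y) (-(2 * r) - s) := by
  obtain ⟨n, ⟨h1, h2, h3⟩ | ⟨h1, h2, h3⟩ | ⟨h1, h2, h3⟩ | ⟨h1, h2, h3⟩⟩ := h <;>
    simp only at h1 h2 h3
  · refine ⟨-n - 1, Or.inr (Or.inl ⟨by simp only; linarith, h2, ?_⟩)⟩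
    push_cast
    linarith
  · refine ⟨-n - 1, Or.inl ⟨by simp only; linarith, h2, ?_⟩⟩
    push_cast
    linarith
  · refine ⟨-n - 2, Or.inr (Or.inr (Or.inl ⟨h1, by simpa using h2, ?_⟩))⟩
    push_cast
    linarith
  · refine ⟨-n - 2, Or.inr (Or.inr (Or.inr ⟨h1, by simpa using h2, ?_⟩))⟩
    push_cast
    linarith

lemma eq_of_int_mul_bounds {c t : ℝ} {n m : ℤ} (h : t = n * c) (h₁ : (m - 1) * c < t)
    (h₂ : t < (m + 1) * c) (hc : 0 < c) : n = m := by
  subst h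
  have h1 := lt_of_mul_lt_mul_right h₁ hc.le
  have h2 := lt_of_mul_lt_mul_right h₂ hc.le
  have h1' : m - 1 < n := by exact_mod_cast h1
  have h2' : n < m + 1 := by exact_mod_cast h2
  omega

/-- The corners of the rectangle have the positions `0` and `-2 r`. -/
lemma AtPosition.mem_cornerSet {r s : ℝ} {q : ℝ × ℝ} (h : AtPosition r q s) (hr : 0 < r)
    (hs : ∃ n : ℤ, s = n * (2 + 4 * r) ∨ s = -(2 * r) + n * (2 + 4 * r)) : q ∈ cornerSet := by
  obtain ⟨x, y⟩ := q
  have hQ : 0 < 2 + 4 * r := by linarith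
  suffices h : |y| = r ∧ (x = 1 + r ∨ x = -(1 + r)) by
    refine Or.inl ?_
    simp only [Set.mem_ofPred_eq, h.1]
    rcases h.2 with e | e
    · left
      linarith
    · right
      linarith
  have abs_r : |r| = r := abs_of_pos hr
  obtain ⟨m, hm⟩ := hs
  obtain ⟨n, ⟨h1, h2, h3⟩ | ⟨h1, h2, h3⟩ | ⟨h1, h2, h3⟩ | ⟨h1, h2, h3⟩⟩ := h <;>
    simp only at h1 h2 h3 <;> obtain ⟨h4, h5⟩ := abs_le.1 h2 <;> rcases hm with hm | hm
  · have e : ((m - n : ℤ) : ℝ) * (2 + 4 * r) = 1 + r - x := by push_cast; linarith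
    have := eq_of_int_mul_bounds (m := 0) e.symm (by push_cast; linarith)
      (by push_cast; linarith) hQ
    rw [this] at e
    exact ⟨by rw [h1, abs_r], Or.inl (by push_cast at e; linarith)⟩
  · have e : ((m - n : ℤ) : ℝ) * (2 + 4 * r) = 1 + 3 * r - x := by push_cast; linarith
    have := eq_of_int_mul_bounds (m := 1) e.symm (by push_cast; linarith)
      (by push_cast; linarith) hQ
    rw [this] at e
    exact ⟨by rw [h1, abs_r], Or.inr (by push_cast at e; linarith)⟩
  · have e : ((m - n : ℤ) : ℝ) * (2 + 4 * r) = 1 + r + x := by push_cast; linarith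
    have := eq_of_int_mul_bounds (m := 0) e.symm (by push_cast; linarith)
      (by push_cast; linarith) hQ
    rw [this] at e
    exact ⟨by rw [h1, abs_neg, abs_r], Or.inr (by push_cast at e; linarith)⟩
  · have e : ((m - n : ℤ) : ℝ) * (2 + 4 * r) = 1 + 3 * r + x := by push_cast; linarith
    have := eq_of_int_mul_bounds (m := 1) e.symm (by push_cast; linarith)
      (by push_cast; linarith) hQ
    rw [this] at e
    exact ⟨by rw [h1, abs_neg, abs_r], Or.inl (by push_cast at e; linarith)⟩
  · have e : ((m - n : ℤ) : ℝ) * (2 + 4 * r) = 2 + 3 * r + y := by push_cast; linarith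
    have := eq_of_int_mul_bounds (m := 1) e.symm (by push_cast; linarith)
      (by push_cast; linarith) hQ
    rw [this] at e
    exact ⟨by rw [show y = r by push_cast at e; linarith, abs_r], Or.inl h1⟩
  · have e : ((m - n : ℤ) : ℝ) * (2 + 4 * r) = 2 + 5 * r + y := by push_cast; linarith
    have := eq_of_int_mul_bounds (m := 1) e.symm (by push_cast; linarith)
      (by push_cast; linarith) hQ
    rw [this] at e
    exact ⟨by rw [show y = -r by push_cast at e; linarith, abs_neg, abs_r], Or.inl h1⟩
  · have e : ((m - n : ℤ) : ℝ) * (2 + 4 * r) = 2 + 3 * r - y := by push_cast; linarith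
    have := eq_of_int_mul_bounds (m := 1) e.symm (by push_cast; linarith)
      (by push_cast; linarith) hQ
    rw [this] at e
    exact ⟨by rw [show y = -r by push_cast at e; linarith, abs_neg, abs_r],
      Or.inr (by linarith)⟩
  · have e : ((m - n : ℤ) : ℝ) * (2 + 4 * r) = 2 + 5 * r - y := by push_cast; linarith
    have := eq_of_int_mul_bounds (m := 1) e.symm (by push_cast; linarith)
      (by push_cast; linarith) hQ
    rw [this] at e
    exact ⟨by rw [show y = r by push_cast at e; linarith, abs_r], Or.inr (by linarith)⟩

/-- The relation says `r (2m - 4n) = 2n`. Either it determines a rational `r`, or both sides vanish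
and so does `m`. -/
lemma eq_zero_of_rotation {r : ℝ} (hr : Irrational r) {m n : ℤ}
    (h : 2 * r * m = n * (2 + 4 * r)) : m = 0 := by
  by_cases h0 : 2 * m - 4 * n = 0
  · have h1 : ((2 * m - 4 * n : ℤ) : ℝ) = 0 := by rw [h0, Int.cast_zero]
    push_cast at h1
    have h2 : (n : ℝ) = 0 := by linear_combination (-1 / 2 : ℝ) * h + r / 2 * h1
    have h3 : n = 0 := by exact_mod_cast h2
    omega
  · exfalso
    have h1 : ((2 * m - 4 * n : ℤ) : ℝ) ≠ 0 := by exact_mod_cast h0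
    apply hr
    refine ⟨(2 * n : ℤ) / (2 * m - 4 * n : ℤ), ?_⟩
    push_cast at h1 ⊢
    rw [div_eq_iff h1]
    linarith

lemma tableMap_orbit {r s : ℝ} {q : ℝ × ℝ} (hr : Irrational r) (hr0 : 0 < r)
    (h : AtPosition r q s)
    (hs : ∀ (k : ℕ) (n : ℤ), s + 2 * r * k ≠ n * (2 + 4 * r) ∧
      s + 2 * r * k ≠ -(4 * r) + n * (2 + 4 * r)) :
    (∀ k, |(tableMap^[k] q).1 - (tableMap^[k] q).2| ≠ 1) ∧
      ∀ k, 1 ≤ k → tableMap^[k] q ≠ q := by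
  have level_ne (k : ℕ) (hk : AtPosition r (tableMap^[k] q) (s + 2 * r * k)) :
      |(tableMap^[k] q).1 - (tableMap^[k] q).2| ≠ 1 := fun hl => by
    obtain ⟨n, hn⟩ := hk.of_level hl
    exact hn.elim (hs k n).1 (hs k n).2
  have pos (k : ℕ) : AtPosition r (tableMap^[k] q) (s + 2 * r * k) := by
    induction k with
    | zero => simpa using h
    | succ k ih =>
      rw [Function.iterate_succ_apply']
      have := ih.tableMap hr0 (level_ne k ih)
      convert this using 1
      push_cast
      ring
  refine ⟨fun k => level_ne k (pos k), fun k hk he => ?_⟩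
  have hp := pos k
  rw [he] at hp
  obtain ⟨n, hn⟩ := hp.unique h hr0
  have := eq_zero_of_rotation hr (m := k) (n := n) (by push_cast; linarith)
  omega

/-- Up to a reflection, a point which is not a corner of its table has an infinite forward orbit
under the billiard map. -/
lemma exists_infinite_orbit {x y : ℝ} (hr : Irrational (tableRadius x y))
    (hxy : (x, y) ∉ cornerSet) : ∃ q : ℝ × ℝ, (q = (x, y) ∨ q = (x, -y)) ∧
      (∀ k, |(tableMap^[k] q).1 - (tableMap^[k] q).2| ≠ 1) ∧
      ∀ k, 1 ≤ k → tableMap^[k] q ≠ q := by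
  obtain ⟨s, hs⟩ := exists_atPosition (x := x) (y := y)
  have hr0 : 0 < tableRadius x y :=
    lt_of_le_of_ne (le_max_of_le_right (abs_nonneg y)) (Ne.symm hr.ne_zero)
  generalize tableRadius x y = r at *
  by_cases hgood : ∀ (k : ℕ) (n : ℤ), s + 2 * r * k ≠ n * (2 + 4 * r) ∧
      s + 2 * r * k ≠ -(4 * r) + n * (2 + 4 * r)
  · exact ⟨(x, y), Or.inl rfl, tableMap_orbit hr hr0 hs hgood⟩
  · refine ⟨(x, -y), Or.inr rfl, tableMap_orbit hr hr0 hs.reflect ?_⟩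
    have hcor (n : ℤ) : s ≠ n * (2 + 4 * r) ∧ s ≠ -(2 * r) + n * (2 + 4 * r) :=
      ⟨fun h => hxy (hs.mem_cornerSet hr0 ⟨n, Or.inl h⟩),
        fun h => hxy (hs.mem_cornerSet hr0 ⟨n, Or.inr h⟩)⟩
    -- A bad forward orbit starts `m` steps before position `0`. The values `m = 0` and `m = 1`
    -- would put the start at a corner; hitting `-4r` adds two steps.
    obtain ⟨m, hm2, l, hl⟩ : ∃ m : ℕ, 2 ≤ m ∧ ∃ l : ℤ, s = -(2 * r * m) + l * (2 + 4 * r) := by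
      simp only [not_forall, not_and_or, not_not] at hgood
      obtain ⟨k, n, h | h⟩ := hgood
      · refine ⟨k, ?_, n, by linarith⟩
        by_contra hk
        interval_cases k
        · exact (hcor n).1 (by push_cast at h; linarith)
        · exact (hcor n).2 (by push_cast at h; linarith)
      · exact ⟨k + 2, by omega, n, by push_cast; linarith⟩
    -- The reflected start is at `2r (m - 1)`, already past position `0` because `m ≥ 2`. Hitting
    -- `0` or `-4r` after `k` steps would give a relation with the positive multiplier `m - 1 + k`
    -- or `m + 1 + k`.
    intro k n
    constructor
    · intro h
      have := eq_zero_of_rotation hr (m := m - 1 + k) (n := n + l) (by push_cast; linarith)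
      omega
    · intro h
      have := eq_zero_of_rotation hr (m := m + 1 + k) (n := n + l) (by push_cast; linarith)
      omega

/-! ### Realising a finite orbit by a Hamiltonian diffeomorphism. -/

lemma exists_margin {c : ℝ} (hc : |c| ≠ 1) :
    ∀ᶠ δ : ℝ in 𝓝[>] 0, c ^ 2 ≤ 1 - 2 * δ ∨ 1 + 2 * δ ≤ |c| := by
  rcases lt_or_gt_of_ne hc with h | h
  · have h1 : c ^ 2 < 1 := (sq_lt_one_iff_abs_lt_one c).2 h
    filter_upwards [nhdsWithin_le_nhds (Iio_mem_nhds (show 0 < (1 - c ^ 2) / 2 by linarith))]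
      with δ hδ
    left
    linarith [Set.mem_Iio.1 hδ]
  · filter_upwards [nhdsWithin_le_nhds (Iio_mem_nhds (show 0 < (|c| - 1) / 2 by linarith))]
      with δ hδ
    right
    linarith [Set.mem_Iio.1 hδ]

/-- Only finitely many levels occur, all different from `±1`, so a small `δ` puts every one of them
outside the collars where the flips are uncontrolled. -/
lemma exists_ham_orbit {α : ℝ} (hα : 0 < α) {q : ℝ × ℝ} (N : ℕ)
    (h : ∀ k, |(tableMap^[k] q).1 - (tableMap^[k] q).2| ≠ 1) :
    ∃ ψ ∈ Ham α, ∀ p, moment α p = q → ∀ k ≤ N, moment α (ψ^[k] p) = tableMap^[k] q := by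
  have hev : ∀ᶠ δ : ℝ in 𝓝[>] 0, ∀ k ∈ Finset.range N,
      ((tableMap^[k] q).1 - (tableMap^[k] q).2) ^ 2 ≤ 1 - 2 * δ ∨
        1 + 2 * δ ≤ |(tableMap^[k] q).1 - (tableMap^[k] q).2| := by
    rw [Filter.eventually_all_finset]
    exact fun k _ => exists_margin (h k)
  obtain ⟨δ, hδ, hδ0⟩ := (hev.and self_mem_nhdsWithin).exists
  obtain ⟨ψ, hψ, hψm⟩ := exists_ham_tableMap hα (Set.mem_Ioi.1 hδ0)
  refine ⟨ψ, hψ, fun p hp k => ?_⟩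
  induction k with
  | zero => exact fun _ => hp
  | succ k ih =>
    intro hk
    have ih := ih (by omega)
    rw [Function.iterate_succ_apply', Function.iterate_succ_apply', hψm, ih]
    rw [ih]
    exact hδ k (Finset.mem_range.2 (by omega))

/-- The reflection of the second factor. -/
abbrev reflectSnd : S2xS2 → S2xS2 := Prod.map (rotX 0) (rotX Real.pi)

lemma reflectSnd_reflectSnd (p : S2xS2) : reflectSnd (reflectSnd p) = p := by
  refine Prod.ext (vec_injective ?_) (vec_injective ?_) <;> funext i <;> fin_cases i <;>
    simp [rotX]

lemma moment_reflectSnd (α : ℝ) (p : S2xS2) :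
    moment α (reflectSnd p) = ((moment α p).1, -(moment α p).2) := by
  rw [moment_rotX, moment]
  simp

end SplitTori

end

theorem proposition1p7 (α : ℝ) (hα : 0 < α) (x y : ℝ)
    (hx : x ∈ Set.Ioo (-1 - α) (1 + α)) (hy : y ∈ Set.Ioo (-α) α)
    (hr : Irrational (SplitTori.tableRadius x y))
    (hxy : (x, y) ∉ SplitTori.cornerSet) (N : ℕ) :
    ∃ ψ ∈ SplitTori.Ham α, ∀ k ∈ Finset.Icc 1 N,
      (ψ^[k] '' SplitTori.splitTorus α x y) ∩ SplitTori.splitTorus α x y = ∅ := by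
  obtain ⟨q, hq, hlev, hper⟩ := SplitTori.exists_infinite_orbit hr hxy
  obtain ⟨ψ, hψ, hψq⟩ := SplitTori.exists_ham_orbit hα N hlev
  rcases hq with rfl | rfl
  · refine ⟨ψ, hψ, fun k hk => Set.eq_empty_iff_forall_notMem.2 ?_⟩
    rw [Finset.mem_Icc] at hk
    rintro _ ⟨⟨p, hp, rfl⟩, hp'⟩
    have h := hψq p (SplitTori.moment_of_mem_splitTorus hp) k hk.2
    rw [SplitTori.moment_of_mem_splitTorus hp'] at h
    exact hper k hk.1 h.symm
  -- Here the good orbit starts at `(x, -y)`, so the map is conjugated by the involution that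
  -- exchanges the moment values `(x, y)` and `(x, -y)`.
  · have hτ : SplitTori.reflectSnd ∈ SplitTori.Ham α :=
      SplitTori.prodMap_rotX_mem_Ham α 0 Real.pi
    refine ⟨SplitTori.reflectSnd ∘ ψ ∘ SplitTori.reflectSnd,
      SplitTori.comp_mem_Ham hτ (SplitTori.comp_mem_Ham hψ hτ),
      fun k hk => Set.eq_empty_iff_forall_notMem.2 ?_⟩
    rw [Finset.mem_Icc] at hk
    rintro _ ⟨⟨p, hp, rfl⟩, hp'⟩
    have hsemi : Function.Semiconj SplitTori.reflectSnd
        (SplitTori.reflectSnd ∘ ψ ∘ SplitTori.reflectSnd) ψ := fun p => by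
      simp only [Function.comp_apply, SplitTori.reflectSnd_reflectSnd]
    have h := hψq (SplitTori.reflectSnd p)
      (by rw [SplitTori.moment_reflectSnd, SplitTori.moment_of_mem_splitTorus hp]) k hk.2
    rw [← (hsemi.iterate_right k).eq, SplitTori.moment_reflectSnd,
      SplitTori.moment_of_mem_splitTorus hp'] at h
    exact hper k hk.1 h.symm
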